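/- Let $d\ge 0$ and $p\ge 1$ be integers and $L_p>0$. Write $f_p(y;x)=\sum_{i=0}^{p}\frac1{i!}\nabla^i f(x)[y-x]^i$ for the $p$-th order Taylor expansion of $f$ at $x$; the $p$-th order Taylor oracle of $f$ answers a query $x\in\mathbb R^d$ by the function $y\mapsto f_p(y;x)$. For $A\ge 0$, $\lambda>0$, $x,y\in\mathbb R^d$ put $a(A,\lambda)=\frac{\lambda+\sqrt{\lambda^2+4\lambda A}}2$ and $\tilde x(A,x,y,\lambda)=\frac{A}{A+a(A,\lambda)}\,y+\frac{a(A,\lambda)}{A+a(A,\lambda)}\,x$. Call $(\lambda,y')$ with $\lambda>0$ an admissible step from the state $(A,x,y)$ if, with $\tilde x=\tilde x(A,x,y,\lambda)$, the point $y'$ minimizes $w\mapsto f_p(w;\tilde x)+\frac{L_p}{p!}\|w-\tilde x\|^{p+1}$ over $\mathbb R^d$ and $$\frac12\le\lambda\,\frac{L_p\|y'-\tilde x\|^{p-1}}{(p-1)!}\le\frac p{p+1}$$ (with $\|\cdot\|^{0}=1$). Accelerated Taylor Descent (ATD) starts from $A_0=0$, $x_0=y_0=0$ and in iteration $k$ chooses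 an admissible step $(\lambda_{k+1},y_{k+1})$ from $(A_k,x_k,y_k)$ and sets $a_{k+1}=a(A_k,\lambda_{k+1})$, $A_{k+1}=A_k+a_{k+1}$, $x_{k+1}=x_k-a_{k+1}\nabla f(y_{k+1})$. (i) Let $f:\mathbb R^d\to\mathbb R$ be convex and $p$ times continuously differentiable with $L_p$-Lipschitz $p$-th derivative, and let $x^*$ be a minimizer of $f$. Then for every $k\ge 1$ and every execution of ATD on $f$ with $k$ iterations, $$f(y_k)-f(x^*)\le\frac{c_pL_p\|x^*\|^{p+1}}{k^{(3p+1)/2}},\qquad c_p=\frac{2^{p-1}(p+1)^{(3p+1)/2}}{(p-1)!}.$$ (ii) Each iteration can be implemented with few oracle calls: there is a deterministic adaptive procedure, depending only on $d,p,L_p$, which, given a number $n\ge0$, a state $(A,x,y)$ and access to an oracle, makes at most $n$ oracle calls and then outputs either a single point or a pair $(\lambda,y')$ (only oracle calls are counted), such that the following holds. For every $f$ and $x^*$ as in (i), every state $(A_k,x_k,y_k)$ reached after $k\ge0$ iterations of an execution of ATD on $f$, every precision $\epsilon>0$ and every integer $$n\ \ge\ \left\lfloor 30p\log_2p+\log_2\left\lceil\frac{L_p\|x^*\|^{p+1}}{\epsilon}\right\rceil\right\rfloor$$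 (with $\log_2 0$ read as $0$ when $x^*=0$), the procedure run from this state with the $p$-th order Taylor oracle of $f$ outputs either a point $y$ with $f(y)-f(x^*)\le\epsilon$, declared as such, or an admissible step $(\lambda_{k+1},y_{k+1})$ from $(A_k,x_k,y_k)$, declared as such. In particular, at each iteration at most $30p\log_2p+\log_2\lceil L_p\|x^*\|^{p+1}/\epsilon\rceil$ calls suffice. -/

import Mathlib

noncomputable section

/-- The ambient space `ℝ^d` with its Euclidean norm. -/
abbrev Vec (d : ℕ) : Type := EuclideanSpace ℝ (Fin d)

/-- `f` is `p` times continuously differentiable and its `p`-th derivative is `L`-Lipschitz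
(for the operator norm on `p`-linear forms). -/
def HasLipschitzDeriv {d : ℕ} (p : ℕ) (L : ℝ) (f : Vec d → ℝ) : Prop :=
  ContDiff ℝ p f ∧
    ∀ x y : Vec d, ‖iteratedFDeriv ℝ p f x - iteratedFDeriv ℝ p f y‖ ≤ L * ‖x - y‖

/-- The `p`-th order Taylor expansion of `f` at `x`, as a function of `y`:
`f_p(y; x) = ∑_{i ≤ p} (1 / i!) ∇^i f(x) [y - x]^i`. -/
def taylorExpansion {d : ℕ} (p : ℕ) (f : Vec d → ℝ) (x : Vec d) : Vec d → ℝ :=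
  fun y => ∑ i ∈ Finset.range (p + 1),
    (1 / (Nat.factorial i : ℝ)) * iteratedFDeriv ℝ i f x (fun _ => y - x)

/-- The regularized model `y ↦ f_p(y; x) + (L / p!) ‖y - x‖^(p+1)`. -/
def regularizedModel {d : ℕ} (p : ℕ) (L : ℝ) (f : Vec d → ℝ) (x : Vec d) : Vec d → ℝ :=
  fun y => taylorExpansion p f x y + L / (Nat.factorial p : ℝ) * ‖y - x‖ ^ (p + 1)

/-- The weight `a_{k+1}` as a function of `A_k` and `λ_{k+1}`. -/
def stepWeight (A lam : ℝ) : ℝ :=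
  (lam + Real.sqrt (lam ^ 2 + 4 * lam * A)) / 2

/-- The point `x̃_k` as a function of `A_k`, `x_k`, `y_k` and `λ_{k+1}`. -/
def extrapolation {d : ℕ} (A : ℝ) (x y : Vec d) (lam : ℝ) : Vec d :=
  (A / (A + stepWeight A lam)) • y + (stepWeight A lam / (A + stepWeight A lam)) • x

/-- In the state `(A_k, x_k, y_k) = (A, x, y)`, the pair `(lam, y')` is an admissible choice of
`(λ_{k+1}, y_{k+1})` in Accelerated Taylor Descent. -/
def IsATDStep {d : ℕ} (p : ℕ) (L : ℝ) (f : Vec d → ℝ) (A : ℝ) (x y : Vec d)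
    (lam : ℝ) (y' : Vec d) : Prop :=
  0 < lam ∧
  1 / 2 ≤ lam * (L * ‖y' - extrapolation A x y lam‖ ^ (p - 1) / (Nat.factorial (p - 1) : ℝ)) ∧
  lam * (L * ‖y' - extrapolation A x y lam‖ ^ (p - 1) / (Nat.factorial (p - 1) : ℝ))
    ≤ (p : ℝ) / ((p : ℝ) + 1) ∧
  IsMinOn (regularizedModel p L f (extrapolation A x y lam)) Set.univ y'

/-- The sequences `A, x, y` (with step sizes `lam`) are the first `K` iterations of an execution of
Accelerated Taylor Descent on `f`. Only the entries with index at most `K` matter. -/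
structure IsATDRun {d : ℕ} (p : ℕ) (L : ℝ) (f : Vec d → ℝ) (K : ℕ)
    (lam A : ℕ → ℝ) (x y : ℕ → Vec d) : Prop where
  A_zero : A 0 = 0
  x_zero : x 0 = 0
  y_zero : y 0 = 0
  step : ∀ k < K, IsATDStep p L f (A k) (x k) (y k) (lam (k + 1)) (y (k + 1))
  A_succ : ∀ k < K, A (k + 1) = A k + stepWeight (A k) (lam (k + 1))
  x_succ : ∀ k < K,
    x (k + 1) = x k - stepWeight (A k) (lam (k + 1)) • gradient f (y (k + 1))

/-- A deterministic adaptive algorithm with access to an oracle that answers a query point of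
`ℝ^d` by a real function on `ℝ^d` (a Taylor expansion). It either stops with an output, or makes
one oracle call and continues depending on the answer. Only oracle calls are charged. -/
inductive OracleAlg (d : ℕ) (Out : Type) : Type
  | output (o : Out) : OracleAlg d Out
  | query (q : Vec d) (next : (Vec d → ℝ) → OracleAlg d Out) : OracleAlg d Out

/-- The output of the algorithm when it is run with the oracle `O`. -/
def OracleAlg.result {d : ℕ} {Out : Type} (O : Vec d → Vec d → ℝ) : OracleAlg d Out → Out
  | .output o => o
  | .query q next => (next (O q)).result O

/-- The number of oracle calls of the algorithm when it is run with the oracle `O`. -/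
def OracleAlg.calls {d : ℕ} {Out : Type} (O : Vec d → Vec d → ℝ) : OracleAlg d Out → ℕ
  | .output _ => 0
  | .query q next => (next (O q)).calls O + 1

/-- What the line search of one iteration returns: a point claimed to be accurate, or the pair
`(λ_{k+1}, y_{k+1})`. -/
inductive SearchOutput (d : ℕ) : Type
  | accurate (y : Vec d) : SearchOutput d
  | iterate (lam : ℝ) (y : Vec d) : SearchOutput d

/-- The output is correct for precision `ε` in the state `(A, x, y)`, where `fmin` is the minimum
of `f`. -/
def SearchOutput.Correct {d : ℕ} (p : ℕ) (L : ℝ) (f : Vec d → ℝ) (fmin ε : ℝ)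
    (A : ℝ) (x y : Vec d) : SearchOutput d → Prop
  | .accurate z => f z - fmin ≤ ε
  | .iterate lam y' => IsATDStep p L f A x y lam y'

end

/-! The rate rests on the Lyapunov function `A (f y - f x*) + ‖x - x*‖² / 2`. With an admissible
`λ`, minimizing the regularized model is an inexact implicit gradient step: `λ ∇f(y')` differs from
`x̃ - y'` by at most `‖y' - x̃‖ / 2` (`norm_smul_gradient_add_le`). Together with `a² = λ (A + a)`
and convexity, this makes the Lyapunov function drop by `(3/8) ((A + a) / λ) ‖y' - x̃‖²` per step
(`IsATDStep.energy_le`). Summation gives `A_k (f y_k - f x*) ≤ ‖x*‖² / 2`, keeps the iterates near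
`x*`, and bounds `∑ s_i²`, where `s_i = A_{i+1} r_i / a_{i+1}` and `r_i` is the step length. Put
`w_i = a_{i+1} A_{i+1}^(1/(p+1) - 1)`. By concavity `∑ w_i` telescopes to at most `(p+1)
A_k^(1/(p+1))`, while admissibility bounds `w_i^(p+1) s_i^(p-1) = λ_{i+1} r_i^(p-1)` from below.
Weighted AM-GM (`mul_rpow_le_of_sum_le`) then forces `A_k` to grow like `k^((3p+1)/2)`
(`IsATDRun.growth`).

For the line search with `p ≥ 2` and `A > 0`, the step size is parametrized by `θ = A / (A + a)`, so
that `x̃` moves along the segment from `x` to `y`, and `θ` is bisected between a too large ratio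
(lower end) and a too small one (upper end). Suppose a bracket of tiny length `h` remains and
neither `y` nor the upper model minimizer `z` is accurate. Near `θ = 1`, inaccuracy of `y` bounds
`A`, so the ratio at the lower end cannot be large. Near `θ = 0`, inaccuracy of `z` means a long
step, so the ratio at the upper end cannot be small. In between, uniform convexity of the model
makes its minimizer Hölder continuous in the center (`norm_sub_pow_le_of_isMinOn_regularizedModel`),
so the two ratios nearly agree, against the gap between `1/2` and `p/(p+1) ≥ 2/3`. The cases `p = 1`
and `A = 0` need one call at most. -/

noncomputable section

/-! ### Symmetry of higher derivatives on diagonal arguments. -/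

section Symmetry

variable {E : Type*} [NormedAddCommGroup E] [NormedSpace ℝ E]

lemma ContDiff.fderiv_apply_const {n : ℕ} {f : E → ℝ} (hf : ContDiff ℝ (n + 1 : ℕ) f) (e : E) :
    ContDiff ℝ n (fun y => fderiv ℝ f y e) :=
  (hf.fderiv_right (m := n) (by norm_cast)).clm_apply contDiff_const

lemma iteratedFDeriv_succ_apply_eq_fderiv_apply {n : ℕ} {f : E → ℝ}
    (hf : ContDiff ℝ (n + 1 : ℕ) f) (x : E) (m : Fin (n + 1) → E) :
    iteratedFDeriv ℝ (n + 1) f x m =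
      iteratedFDeriv ℝ n (fun y => fderiv ℝ f y (m (Fin.last n))) x (Fin.init m) := by
  rw [iteratedFDeriv_succ_apply_right]
  have h := (ContinuousLinearMap.apply ℝ ℝ (m (Fin.last n))).iteratedFDeriv_comp_left
    (f := fderiv ℝ f) (x := x) (n := n)
    (hf.fderiv_right (m := n) (by norm_cast)).contDiffAt (i := n) le_rfl
  have h2 : (fun y => fderiv ℝ f y (m (Fin.last n)))
      = (ContinuousLinearMap.apply ℝ ℝ (m (Fin.last n))) ∘ fderiv ℝ f := by
    ext y; simp
  rw [h2, h]
  simp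

lemma iteratedFDeriv_succ_apply_const {n : ℕ} {f : E → ℝ} (hf : ContDiff ℝ (n + 1 : ℕ) f) (x w : E) :
    iteratedFDeriv ℝ (n + 1) f x (fun _ => w) =
      iteratedFDeriv ℝ n (fun y => fderiv ℝ f y w) x (fun _ => w) :=
  iteratedFDeriv_succ_apply_eq_fderiv_apply hf x _

lemma fderiv_fderiv_apply_comm {f : E → ℝ} (hf : ContDiff ℝ 2 f) (u v : E) :
    (fun y => fderiv ℝ (fun z => fderiv ℝ f z u) y v) =
      fun y => fderiv ℝ (fun z => fderiv ℝ f z v) y u := by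
  have hd : Differentiable ℝ (fderiv ℝ f) :=
    (hf.fderiv_right (m := 1) (by norm_num)).differentiable one_ne_zero
  have key : ∀ a b y, fderiv ℝ (fun z => fderiv ℝ f z a) y b = fderiv ℝ (fderiv ℝ f) y b a := by
    intro a b y
    rw [fderiv_clm_apply (hd y) (differentiableAt_const a)]
    simp
  ext y
  rw [key, key]
  exact (hf.contDiffAt (x := y)).isSymmSndFDerivAt (by simp) v u

/-- Induction peeling off the last slot: if it holds `w`, the claim is applied to `∂_w f`, and
`∂_w`, `∂_e` are then exchanged. Only symmetry of the second derivative is needed. -/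
lemma iteratedFDeriv_update_const {n : ℕ} : ∀ {f : E → ℝ} (_ : ContDiff ℝ (n + 1 : ℕ) f)
    (x w e : E) (j : Fin (n + 1)),
    iteratedFDeriv ℝ (n + 1) f x (Function.update (fun _ => w) j e) =
      iteratedFDeriv ℝ n (fun y => fderiv ℝ f y e) x (fun _ => w) := by
  induction n with
  | zero =>
    intro f hf x w e j
    rw [iteratedFDeriv_succ_apply_eq_fderiv_apply hf]
    have : j = Fin.last 0 := Fin.ext (by simp)
    subst this
    simp
  | succ n ih =>
    intro f hf x w e j
    rw [iteratedFDeriv_succ_apply_eq_fderiv_apply hf]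
    refine Fin.lastCases ?_ (fun j' => ?_) j
    · simp only [Function.update_self]
      congr 1
      ext i : 1
      simp [Fin.init]
    · rw [Function.update_of_ne (Fin.castSucc_lt_last j').ne']
      have h1 : Fin.init (Function.update (fun _ : Fin (n + 1 + 1) => w) j'.castSucc e)
          = Function.update (fun _ => w) j' e := by
        rw [Fin.init_update_castSucc]; rfl
      rw [h1, ih (hf.fderiv_apply_const w), fderiv_fderiv_apply_comm
        (hf.of_le (by norm_cast; omega)), ← iteratedFDeriv_succ_apply_const (hf.fderiv_apply_const e)]

lemma hasFDerivAt_iteratedFDeriv_const {n : ℕ} {f : E → ℝ} (hf : ContDiff ℝ (n + 1 : ℕ) f)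
    (x w : E) : ∃ g : E →L[ℝ] ℝ,
      HasFDerivAt (fun w => iteratedFDeriv ℝ (n + 1) f x (fun _ => w)) g w ∧
      ∀ e, g e = (n + 1 : ℝ) * iteratedFDeriv ℝ n (fun y => fderiv ℝ f y e) x (fun _ => w) := by
  have h1 : HasFDerivAt (fun w : E => (fun _ : Fin (n + 1) => w))
      (ContinuousLinearMap.pi fun _ => ContinuousLinearMap.id ℝ E) w :=
    hasFDerivAt_pi.2 fun _ => hasFDerivAt_id w
  refine ⟨_, ((iteratedFDeriv ℝ (n + 1) f x).hasFDerivAt (fun _ => w)).comp w h1, fun e => ?_⟩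
  simp [ContinuousMultilinearMap.linearDeriv_apply, iteratedFDeriv_update_const hf]

end Symmetry

/-! ### Taylor expansions and their remainders. -/

section Taylor

variable {d : ℕ}

lemma taylorExpansion_zero (f : Vec d → ℝ) (x y : Vec d) : taylorExpansion 0 f x y = f x := by
  simp [taylorExpansion]

lemma taylorExpansion_self (p : ℕ) (f : Vec d → ℝ) (x : Vec d) : taylorExpansion p f x x = f x := by
  unfold taylorExpansion
  rw [Finset.sum_range_succ', Finset.sum_eq_zero]
  · simp
  · intro i _
    rw [ContinuousMultilinearMap.map_coord_zero _ (0 : Fin (i + 1)) (by simp)]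
    simp

/-- Differentiation commutes with Taylor expansion and lowers the order by one. With
`HasLipschitzDeriv.fderiv_apply` it drives the inductions on `p` below. -/
lemma hasFDerivAt_taylorExpansion {p : ℕ} {f : Vec d → ℝ} (hf : ContDiff ℝ (p + 1 : ℕ) f)
    (x w : Vec d) : ∃ g : Vec d →L[ℝ] ℝ, HasFDerivAt (taylorExpansion (p + 1) f x) g w ∧
      ∀ e, g e = taylorExpansion p (fun y => fderiv ℝ f y e) x w := by
  have h1 : ∀ i : ℕ, ∃ g : Vec d →L[ℝ] ℝ, i ∈ Finset.range (p + 1) →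
      HasFDerivAt (fun y => (1 / (Nat.factorial (i + 1) : ℝ)) *
        iteratedFDeriv ℝ (i + 1) f x (fun _ => y - x)) g w ∧
      ∀ e, g e = (1 / (Nat.factorial i : ℝ)) *
        iteratedFDeriv ℝ i (fun y => fderiv ℝ f y e) x (fun _ => w - x) := by
    intro i
    by_cases hi : i ∈ Finset.range (p + 1)
    · have hi' : i + 1 ≤ p + 1 := by simpa using hi
      obtain ⟨g, hg, hge⟩ := hasFDerivAt_iteratedFDeriv_const
        (hf.of_le (m := ((i + 1 : ℕ) : WithTop ℕ∞)) (by exact_mod_cast hi')) x (w - x)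
      refine ⟨_, fun _ => ⟨(hg.comp w ((hasFDerivAt_id w).sub_const x)).const_mul _, fun e => ?_⟩⟩
      simp only [ContinuousLinearMap.comp_id, smul_apply, hge, smul_eq_mul,
        Nat.factorial_succ]
      push_cast
      have : (i.factorial : ℝ) ≠ 0 := by positivity
      field_simp
    · exact ⟨0, fun h => absurd h hi⟩
  choose g hg using h1
  refine ⟨∑ i ∈ Finset.range (p + 1), g i, ?_, fun e => ?_⟩
  · have h2 := (HasFDerivAt.fun_sum fun i hi => (hg i hi).1).add_const (f x)
    refine h2.congr_of_eventuallyEq (Filter.Eventually.of_forall fun y => ?_)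
    simp [taylorExpansion, Finset.sum_range_succ' _ (p + 1)]
  · simp only [sum_apply, taylorExpansion]
    exact Finset.sum_congr rfl fun i hi => (hg i hi).2 e

lemma HasLipschitzDeriv.fderiv_apply {p : ℕ} {L : ℝ} {f : Vec d → ℝ}
    (hf : HasLipschitzDeriv (p + 1) L f) (e : Vec d) :
    HasLipschitzDeriv p (L * ‖e‖) (fun y => fderiv ℝ f y e) := by
  refine ⟨hf.1.fderiv_apply_const e, fun x y => ?_⟩
  have hL : 0 ≤ L * ‖x - y‖ := (norm_nonneg _).trans (hf.2 x y)
  refine ContinuousMultilinearMap.opNorm_le_bound (by nlinarith [norm_nonneg e]) fun m => ?_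
  have h1 : ∀ z, iteratedFDeriv ℝ p (fun y => fderiv ℝ f y e) z m
      = iteratedFDeriv ℝ (p + 1) f z (Fin.snoc m e) := by
    intro z
    rw [iteratedFDeriv_succ_apply_eq_fderiv_apply hf.1]
    simp
  have h2 := (iteratedFDeriv ℝ (p + 1) f x - iteratedFDeriv ℝ (p + 1) f y).le_of_opNorm_le
    (hf.2 x y) (Fin.snoc m e)
  rw [Fin.prod_univ_castSucc] at h2
  simp only [Fin.snoc_castSucc, Fin.snoc_last, sub_apply] at h2
  rw [sub_apply, h1, h1]
  calc _ ≤ _ := h2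
    _ = _ := by ring

/-- Mean value comparison along the segment from `x` to `x + u`. -/
lemma norm_le_of_norm_fderiv_le {g : Vec d → ℝ} (hg : Differentiable ℝ g) (x u : Vec d)
    {B B' : ℝ → ℝ} (h0 : |g x| ≤ B 0) (hB : ∀ t, HasDerivAt B (B' t) t)
    (h : ∀ t, 0 ≤ t → |fderiv ℝ g (x + t • u) u| ≤ B' t) : |g (x + u)| ≤ B 1 := by
  have hd : ∀ t : ℝ, HasDerivAt (fun t : ℝ => g (x + t • u)) (fderiv ℝ g (x + t • u) u) t := by
    intro t
    have h1 : HasDerivAt (fun t : ℝ => x + t • u) u t := by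
      simpa using ((hasDerivAt_id t).smul_const u).const_add x
    exact (hg (x + t • u)).hasFDerivAt.comp_hasDerivAt t h1
  have := image_norm_le_of_norm_deriv_right_le_deriv_boundary (a := 0) (b := 1)
    (f := fun t : ℝ => g (x + t • u)) (fun t _ => (hd t).continuousAt.continuousWithinAt)
    (fun t _ => (hd t).hasDerivWithinAt) (B := B) (by simpa using h0) hB
    (fun t ht => by simpa using h t ht.1) (x := 1) (by simp)
  simpa using this

lemma differentiable_taylorExpansion {p : ℕ} {f : Vec d → ℝ} (hf : ContDiff ℝ p f)
    (x : Vec d) : Differentiable ℝ (taylorExpansion p f x) := by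
  intro w
  cases p with
  | zero =>
    have : taylorExpansion 0 f x = fun _ => f x := by ext; simp [taylorExpansion]
    rw [this]; exact differentiableAt_const _
  | succ p => 
    obtain ⟨g, hg, -⟩ := hasFDerivAt_taylorExpansion hf x w
    exact hg.differentiableAt

lemma fderiv_taylorExpansion {p : ℕ} {f : Vec d → ℝ} (hf : ContDiff ℝ (p + 1 : ℕ) f)
    (x w e : Vec d) :
    fderiv ℝ (taylorExpansion (p + 1) f x) w e = taylorExpansion p (fun y => fderiv ℝ f y e) x w := by
  obtain ⟨g, hg, hge⟩ := hasFDerivAt_taylorExpansion hf x w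
  rw [hg.fderiv, hge]

/-- The derivative of the remainder in direction `u` is the remainder of `∂_u f` at one order less;
the induction hypothesis is integrated along the segment. -/
lemma HasLipschitzDeriv.abs_sub_taylorExpansion_le {p : ℕ} : ∀ {L : ℝ} {f : Vec d → ℝ}
    (_ : HasLipschitzDeriv p L f) (x u : Vec d),
    |f (x + u) - taylorExpansion p f x (x + u)| ≤ L / (Nat.factorial (p + 1) : ℝ) * ‖u‖ ^ (p + 1) := by
  induction p with
  | zero =>
    intro L f hf x u
    have h := hf.2 (x + u) x
    have h2 := (iteratedFDeriv ℝ 0 f (x + u) - iteratedFDeriv ℝ 0 f x).le_of_opNorm_le h 0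
    simpa [taylorExpansion_zero] using h2
  | succ p ih =>
    intro L f hf x u
    have hfd : Differentiable ℝ f := hf.1.differentiable (by norm_cast)
    have htd := differentiable_taylorExpansion hf.1 x
    have key := norm_le_of_norm_fderiv_le (hfd.sub htd) x u
      (B := fun t => L / (Nat.factorial (p + 1 + 1) : ℝ) * ‖u‖ ^ (p + 1 + 1) * t ^ (p + 1 + 1))
      (B' := fun t => L / (Nat.factorial (p + 1 + 1) : ℝ) * ‖u‖ ^ (p + 1 + 1) *
        ((p + 1 + 1 : ℕ) * t ^ (p + 1)))
      (by simp [taylorExpansion_self]) (fun t => by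
        simpa using (hasDerivAt_pow (p + 1 + 1) t).const_mul
          (L / (Nat.factorial (p + 1 + 1) : ℝ) * ‖u‖ ^ (p + 1 + 1))) ?_
    · simpa using key
    · intro t ht
      rw [fderiv_sub (hfd _) (htd _), sub_apply, fderiv_taylorExpansion hf.1]
      refine (ih (hf.fderiv_apply u) x (t • u)).trans (le_of_eq ?_)
      rw [norm_smul, Real.norm_of_nonneg ht, Nat.factorial_succ (p + 1)]
      push_cast
      have : ((p + 1).factorial : ℝ) ≠ 0 := by positivity
      field_simp
      ring

/-- Same induction along the segment from `v`; at its start the difference is the remainder at `v`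
of the expansion around `x`. -/
lemma HasLipschitzDeriv.abs_taylorExpansion_sub_le {p : ℕ} : ∀ {L : ℝ} {f : Vec d → ℝ}
    (_ : HasLipschitzDeriv p L f) (x v u : Vec d),
    |taylorExpansion p f x (v + u) - taylorExpansion p f v (v + u)| ≤
      L / (Nat.factorial (p + 1) : ℝ) * ((‖x - v‖ + ‖u‖) ^ (p + 1) - ‖u‖ ^ (p + 1)) := by
  induction p with
  | zero =>
    intro L f hf x v u
    have h := hf.abs_sub_taylorExpansion_le v (x - v)
    simpa [taylorExpansion_zero] using h
  | succ p ih =>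
    intro L f hf x v u
    have h1 := differentiable_taylorExpansion hf.1 x
    have h2 := differentiable_taylorExpansion hf.1 v
    set s := ‖x - v‖
    have key := norm_le_of_norm_fderiv_le (h1.sub h2) v u
      (B := fun t => L / (Nat.factorial (p + 1 + 1) : ℝ) *
        ((s + t * ‖u‖) ^ (p + 1 + 1) - (t * ‖u‖) ^ (p + 1 + 1)))
      (B' := fun t => L / (Nat.factorial (p + 1 + 1) : ℝ) *
        ((p + 1 + 1 : ℕ) * (s + t * ‖u‖) ^ (p + 1) * ‖u‖ -
          (p + 1 + 1 : ℕ) * (t * ‖u‖) ^ (p + 1) * ‖u‖))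
      ?_ ?_ ?_
    · simpa using key
    · have h := hf.abs_sub_taylorExpansion_le x (v - x)
      rw [add_sub_cancel, norm_sub_rev v x] at h
      simpa [taylorExpansion_self, abs_sub_comm] using h
    · intro t
      have h3 : HasDerivAt (fun t : ℝ => t * ‖u‖) ‖u‖ t := by
        simpa using (hasDerivAt_id t).mul_const ‖u‖
      have := (((h3.const_add s).pow (p + 1 + 1)).sub (h3.pow (p + 1 + 1))).const_mul
        (L / (Nat.factorial (p + 1 + 1) : ℝ))
      simpa using this
    · intro t ht
      rw [fderiv_sub (h1 _) (h2 _), sub_apply, fderiv_taylorExpansion hf.1,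
        fderiv_taylorExpansion hf.1]
      refine (ih (hf.fderiv_apply u) x v (t • u)).trans (le_of_eq ?_)
      rw [norm_smul, Real.norm_of_nonneg ht, Nat.factorial_succ (p + 1)]
      push_cast
      have : ((p + 1).factorial : ℝ) ≠ 0 := by positivity
      field_simp
      ring

end Taylor

/-! ### The regularized model and its minimizers. -/

section Model

variable {d p : ℕ} {L : ℝ} {f : Vec d → ℝ}

lemma hasDerivAt_comp_line {g : Vec d → ℝ} {g' : Vec d →L[ℝ] ℝ} {a e : Vec d} {t : ℝ}
    (hg : HasFDerivAt g g' (a + t • e)) : HasDerivAt (fun t : ℝ => g (a + t • e)) (g' e) t := by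
  have h1 : HasDerivAt (fun t : ℝ => a + t • e) e t := by
    simpa using ((hasDerivAt_id t).smul_const e).const_add a
  exact hg.comp_hasDerivAt t h1

lemma ConvexOn.comp_line {g : Vec d → ℝ} (hg : ConvexOn ℝ Set.univ g) (a e : Vec d) :
    ConvexOn ℝ Set.univ (fun t : ℝ => g (a + t • e)) := by
  refine ⟨convex_univ, fun s _ t _ α β hα hβ hαβ => ?_⟩
  have := hg.2 (Set.mem_univ (a + s • e)) (Set.mem_univ (a + t • e)) hα hβ hαβ
  convert this using 2
  have h : a = α • a + β • a := by rw [← add_smul, hαβ, one_smul]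
  conv_lhs => rw [h]
  simp only [smul_eq_mul]
  module

lemma ConvexOn.add_fderiv_le {g : Vec d → ℝ} (hg : ConvexOn ℝ Set.univ g) {y : Vec d}
    (hd : DifferentiableAt ℝ g y) (z : Vec d) : g y + fderiv ℝ g y (z - y) ≤ g z := by
  have h1 : HasDerivAt (fun t : ℝ => g (y + t • (z - y))) (fderiv ℝ g y (z - y)) 0 :=
    hasDerivAt_comp_line (by simpa using hd.hasFDerivAt)
  have h2 := (hg.comp_line y (z - y)).le_slope_of_hasDerivAt (Set.mem_univ 0) (Set.mem_univ 1)
    zero_lt_one h1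
  simp only [slope_def_field, zero_smul, one_smul, add_zero, add_sub_cancel, sub_zero,
    div_one] at h2
  linarith

lemma ConvexOn.fderiv_fderiv_nonneg {g : Vec d → ℝ} (hg : ConvexOn ℝ Set.univ g)
    (hd : ContDiff ℝ 2 g) (a e : Vec d) : 0 ≤ fderiv ℝ (fun y => fderiv ℝ g y e) a e := by
  have h0 : ContDiff ℝ 1 (fun y => fderiv ℝ g y e) :=
    ContDiff.fderiv_apply_const (n := 1) (by exact_mod_cast hd) e
  have h1 : ∀ t, HasDerivAt (fun t : ℝ => g (a + t • e)) (fderiv ℝ g (a + t • e) e) t := fun t =>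
    hasDerivAt_comp_line ((hd.differentiable two_ne_zero) _).hasFDerivAt
  have h2 : HasDerivAt (fun t : ℝ => fderiv ℝ g (a + t • e) e)
      (fderiv ℝ (fun y => fderiv ℝ g y e) a e) 0 :=
    hasDerivAt_comp_line (g := fun y => fderiv ℝ g y e)
      (by simpa using ((h0.differentiable one_ne_zero) a).hasFDerivAt)
  have h3 := (hg.comp_line a e).monotoneOn_deriv fun t _ => (h1 t).differentiableAt
  rw [funext fun t => (h1 t).deriv] at h3
  have h4 := h3.derivWithin_nonneg (x := 0)
  rwa [derivWithin_univ, h2.deriv] at h4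

lemma hasFDerivAt_norm_sub_pow (hp : 1 ≤ p) (x w : Vec d) :
    HasFDerivAt (fun w : Vec d => ‖w - x‖ ^ (p + 1))
      (((p + 1 : ℝ) * ‖w - x‖ ^ (p - 1)) • innerSL ℝ (w - x)) w := by
  have h1 := hasFDerivAt_norm_rpow (w - x) (p := ((p + 1 : ℕ) : ℝ)) (by
    push_cast
    have : (1 : ℝ) ≤ p := by exact_mod_cast hp
    linarith)
  have h2 := h1.comp w ((hasFDerivAt_id w).sub_const x)
  have h3 : ((p + 1 : ℕ) : ℝ) - 2 = ((p - 1 : ℕ) : ℝ) := by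
    push_cast [Nat.cast_sub hp]; ring
  rw [h3, Real.rpow_natCast] at h2
  simp only [ContinuousLinearMap.comp_id] at h2
  refine (h2.congr_of_eventuallyEq (Filter.Eventually.of_forall fun y => ?_)).congr_fderiv ?_
  · simp only [Function.comp, Real.rpow_natCast, id]
  · push_cast; rfl

lemma HasLipschitzDeriv.differentiable (hp : 1 ≤ p) (hf : HasLipschitzDeriv p L f) :
    Differentiable ℝ f :=
  hf.1.differentiable (by norm_cast; omega)

lemma HasLipschitzDeriv.continuous_regularizedModel (hf : HasLipschitzDeriv p L f)
    (x : Vec d) : Continuous (regularizedModel p L f x) :=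
  (differentiable_taylorExpansion hf.1 x).continuous.add (by fun_prop)

/-- First-order optimality of a minimizer of the regularized model. -/
lemma fderiv_taylorExpansion_of_isMinOn (hp : 1 ≤ p) (hf : HasLipschitzDeriv p L f) {x y : Vec d}
    (hy : IsMinOn (regularizedModel p L f x) Set.univ y) (e : Vec d) :
    fderiv ℝ (taylorExpansion p f x) y e =
      -(L * (p + 1) / (Nat.factorial p : ℝ) * ‖y - x‖ ^ (p - 1) * inner ℝ (y - x) e) := by
  have h1 := ((differentiable_taylorExpansion hf.1 x) y).hasFDerivAt.add
    ((hasFDerivAt_norm_sub_pow hp x y).const_mul (L / (Nat.factorial p : ℝ)))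
  have h2 : IsLocalMin (regularizedModel p L f x) y := hy.isLocalMin Filter.univ_mem
  have h3 := congrArg (fun g => g e) (h2.hasFDerivAt_eq_zero h1)
  simp only [add_apply, smul_apply, innerSL_apply_apply, smul_eq_mul, zero_apply] at h3
  rw [eq_neg_of_add_eq_zero_left h3]
  ring

lemma HasLipschitzDeriv.abs_fderiv_sub_le (hp : 1 ≤ p) (hf : HasLipschitzDeriv p L f)
    (x y e : Vec d) :
    |fderiv ℝ f y e - fderiv ℝ (taylorExpansion p f x) y e| ≤
      L / (Nat.factorial p : ℝ) * ‖y - x‖ ^ p * ‖e‖ := by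
  obtain ⟨q, rfl⟩ : ∃ q, p = q + 1 := ⟨p - 1, by omega⟩
  rw [fderiv_taylorExpansion hf.1]
  have := (hf.fderiv_apply e).abs_sub_taylorExpansion_le x (y - x)
  rw [add_sub_cancel] at this
  exact this.trans (le_of_eq (by ring))

lemma inner_gradient_eq_fderiv (y e : Vec d) : inner ℝ (gradient f y) e = fderiv ℝ f y e := by
  rw [gradient, InnerProductSpace.toDual_symm_apply]

lemma norm_le_of_forall_inner_le {v : Vec d} {C : ℝ} (hC : 0 ≤ C)
    (h : ∀ e, inner ℝ v e ≤ C * ‖e‖) : ‖v‖ ≤ C := by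
  rcases eq_or_lt_of_le (norm_nonneg v) with h0 | h0
  · rwa [← h0]
  · have := h v
    rw [real_inner_self_eq_norm_mul_norm] at this
    exact le_of_mul_le_mul_right this h0

lemma factorial_eq_mul_pred (hp : 1 ≤ p) :
    (Nat.factorial p : ℝ) = p * (Nat.factorial (p - 1) : ℝ) := by
  rw [← Nat.mul_factorial_pred (by omega : p ≠ 0)]; push_cast; ring

/-- A step is, up to half of its length, an implicit gradient step. -/
lemma norm_smul_gradient_add_le (hp : 1 ≤ p) (hL : 0 < L) (hf : HasLipschitzDeriv p L f)
    {x y : Vec d} (hy : IsMinOn (regularizedModel p L f x) Set.univ y) {lam : ℝ} (hlam : 0 < lam)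
    (h1 : 1 / 2 ≤ lam * (L * ‖y - x‖ ^ (p - 1) / (Nat.factorial (p - 1) : ℝ)))
    (h2 : lam * (L * ‖y - x‖ ^ (p - 1) / (Nat.factorial (p - 1) : ℝ)) ≤ (p : ℝ) / ((p : ℝ) + 1)) :
    ‖lam • gradient f y + (y - x)‖ ≤ ‖y - x‖ / 2 := by
  have hr := norm_nonneg (y - x)
  set r := ‖y - x‖ with hrdef
  set η := lam * (L * r ^ (p - 1) / (Nat.factorial (p - 1) : ℝ)) with hη
  have hp0 : (0 : ℝ) < p := by exact_mod_cast hp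
  have hfac : (0 : ℝ) < Nat.factorial (p - 1) := by positivity
  -- Optimality makes the model part `λ ∇f_p` equal to `-(η (p+1)/p) (y - x)`, and the Taylor error
  -- adds at most `η r / p`. The upper bound on `η` keeps the remaining coefficient of `y - x`
  -- nonnegative, so the total is `(1 - η) r`, and `η ≥ 1/2` finishes.
  have hηp : 0 ≤ 1 - η * (p + 1) / p := by
    rw [sub_nonneg, div_le_one hp0]
    rwa [le_div_iff₀ (by positivity)] at h2
  have key : ∀ e, inner ℝ (lam • gradient f y + (y - x)) e ≤ (r / 2) * ‖e‖ := by
    intro e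
    rw [inner_add_left, real_inner_smul_left, inner_gradient_eq_fderiv]
    have h3 := (abs_le.1 (hf.abs_fderiv_sub_le hp x y e)).2
    rw [fderiv_taylorExpansion_of_isMinOn hp hf hy, factorial_eq_mul_pred hp, ← hrdef] at h3
    have h4 := real_inner_le_norm (y - x) e
    have h5 : lam * (L / (p * (Nat.factorial (p - 1) : ℝ)) * r ^ p * ‖e‖) = η / p * (r * ‖e‖) := by
      have : r ^ p = r ^ (p - 1) * r := by rw [← pow_succ, Nat.sub_add_cancel hp]
      rw [hη, this]; field_simp
    have h6 : lam * (L * (p + 1) / (p * (Nat.factorial (p - 1) : ℝ)) * r ^ (p - 1)) =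
        η * (p + 1) / p := by
      rw [hη]; field_simp
    have h7 : lam * fderiv ℝ f y e ≤ η / p * (r * ‖e‖) - η * (p + 1) / p * inner ℝ (y - x) e := by
      rw [← h5, ← h6]
      nlinarith [mul_le_mul_of_nonneg_left h3 hlam.le]
    have h8 := mul_le_mul_of_nonneg_left h4 hηp
    have h9 : η / p * (r * ‖e‖) + (1 - η * (p + 1) / p) * (r * ‖e‖) = (1 - η) * (r * ‖e‖) := by
      field_simp; ring
    have h10 : (1 - η) * (r * ‖e‖) ≤ 1 / 2 * (r * ‖e‖) :=
      mul_le_mul_of_nonneg_right (by linarith) (by positivity)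
    linarith
  exact norm_le_of_forall_inner_le (by positivity) key

lemma abs_fderiv_le_of_isMinOn (hp : 1 ≤ p) (hL : 0 < L) (hf : HasLipschitzDeriv p L f)
    {x y : Vec d} (hy : IsMinOn (regularizedModel p L f x) Set.univ y) (e : Vec d) :
    |fderiv ℝ f y e| ≤ L * (p + 2) / (Nat.factorial p : ℝ) * ‖y - x‖ ^ p * ‖e‖ := by
  have h3 := hf.abs_fderiv_sub_le hp x y e
  have h4 : |fderiv ℝ (taylorExpansion p f x) y e| ≤
      L * (p + 1) / (Nat.factorial p : ℝ) * ‖y - x‖ ^ p * ‖e‖ := by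
    rw [fderiv_taylorExpansion_of_isMinOn hp hf hy, abs_neg, abs_mul, abs_of_nonneg (by positivity)]
    have : ‖y - x‖ ^ p = ‖y - x‖ ^ (p - 1) * ‖y - x‖ := by rw [← pow_succ, Nat.sub_add_cancel hp]
    rw [this]
    calc _ ≤ L * (p + 1) / (Nat.factorial p : ℝ) * ‖y - x‖ ^ (p - 1) * (‖y - x‖ * ‖e‖) := by
          gcongr; exact abs_real_inner_le_norm _ _
      _ = _ := by ring
  have h5 := (abs_add_le _ _).trans (add_le_add h3 h4)
  rw [sub_add_cancel] at h5
  exact h5.trans (le_of_eq (by ring))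

/-- A short step certifies accuracy, because the gradient at the new point is of order `‖y - x‖ ^
p`. The line search uses the contrapositive. -/
lemma sub_le_of_isMinOn_regularizedModel (hp : 1 ≤ p) (hL : 0 < L) (hf : HasLipschitzDeriv p L f)
    (hc : ConvexOn ℝ Set.univ f)
    {x y : Vec d} (hy : IsMinOn (regularizedModel p L f x) Set.univ y) (z : Vec d) :
    f y - f z ≤ L * (p + 2) / (Nat.factorial p : ℝ) * ‖y - x‖ ^ p * ‖y - z‖ := by
  have h1 := hc.add_fderiv_le (hf.differentiable hp y) z
  have h2 := (abs_le.1 (abs_fderiv_le_of_isMinOn hp hL hf hy (z - y))).1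
  rw [norm_sub_rev z y] at h2
  linarith

/-- The weight `L / p!` is `p + 1` times the remainder constant `L / (p+1)!`, so `p` shares are left
over; they give coercivity. -/
lemma le_regularizedModel (hf : HasLipschitzDeriv p L f) (x w : Vec d) :
    f w + p * L / (Nat.factorial (p + 1) : ℝ) * ‖w - x‖ ^ (p + 1) ≤ regularizedModel p L f x w := by
  have h := hf.abs_sub_taylorExpansion_le x (w - x)
  rw [add_sub_cancel] at h
  have h1 := (abs_le.1 h).2
  have h2 : L / (Nat.factorial p : ℝ) = L / (Nat.factorial (p + 1) : ℝ) * (p + 1) := by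
    rw [Nat.factorial_succ]; push_cast; field_simp
  unfold regularizedModel
  rw [h2]
  have : L / (Nat.factorial (p + 1) : ℝ) * (p + 1) * ‖w - x‖ ^ (p + 1) =
    L / (Nat.factorial (p + 1) : ℝ) * ‖w - x‖ ^ (p + 1) +
      p * L / (Nat.factorial (p + 1) : ℝ) * ‖w - x‖ ^ (p + 1) := by ring
  linarith

lemma regularizedModel_le (hf : HasLipschitzDeriv p L f) (x w : Vec d) :
    regularizedModel p L f x w ≤
      f w + (p + 2) * L / (Nat.factorial (p + 1) : ℝ) * ‖w - x‖ ^ (p + 1) := by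
  have h := hf.abs_sub_taylorExpansion_le x (w - x)
  rw [add_sub_cancel] at h
  have h1 := (abs_le.1 h).1
  have h2 : L / (Nat.factorial p : ℝ) = L / (Nat.factorial (p + 1) : ℝ) * (p + 1) := by
    rw [Nat.factorial_succ]; push_cast; field_simp
  unfold regularizedModel
  rw [h2]
  have : L / (Nat.factorial (p + 1) : ℝ) * (p + 1) * ‖w - x‖ ^ (p + 1) =
    (p + 2) * L / (Nat.factorial (p + 1) : ℝ) * ‖w - x‖ ^ (p + 1) -
      L / (Nat.factorial (p + 1) : ℝ) * ‖w - x‖ ^ (p + 1) := by ring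
  linarith

lemma exists_isMinOn_regularizedModel (hp : 1 ≤ p) (hL : 0 < L) (hf : HasLipschitzDeriv p L f)
    {xmin : Vec d} (hmin : IsMinOn f Set.univ xmin) (x : Vec d) :
    ∃ y, IsMinOn (regularizedModel p L f x) Set.univ y := by
  have h1 : Filter.Tendsto (regularizedModel p L f x) (Filter.cocompact (Vec d)) Filter.atTop := by
    have h2 : Filter.Tendsto (fun w : Vec d => ‖w - x‖) (Filter.cocompact (Vec d)) Filter.atTop := by
      have := (Homeomorph.subRight x).isClosedEmbedding.tendsto_cocompact
      exact tendsto_norm_cocompact_atTop.comp this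
    have h3 := (Filter.tendsto_pow_atTop (α := ℝ) (n := p + 1) (by omega)).comp h2
    have hp0 : (0 : ℝ) < p := by exact_mod_cast hp
    have h4 := (h3.const_mul_atTop (r := p * L / (Nat.factorial (p + 1) : ℝ)) (by positivity))
    have h5 := Filter.tendsto_atTop_add_const_left _ (f xmin) h4
    refine Filter.tendsto_atTop_mono (fun w => ?_) h5
    have h6 := le_regularizedModel hf x w
    have h7 : f xmin ≤ f w := hmin (Set.mem_univ w)
    simp only [Function.comp]
    linarith
  obtain ⟨y, hy⟩ := (hf.continuous_regularizedModel x).exists_forall_le h1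
  exact ⟨y, fun w _ => hy w⟩

lemma norm_sub_le_of_isMinOn_regularizedModel (hp : 1 ≤ p) (hL : 0 < L)
    (hf : HasLipschitzDeriv p L f) {xmin : Vec d} (hmin : IsMinOn f Set.univ xmin) {x y : Vec d}
    (hy : IsMinOn (regularizedModel p L f x) Set.univ y) : ‖y - x‖ ≤ 2 * ‖x - xmin‖ := by
  have h1 := le_regularizedModel hf x y
  have h2 := regularizedModel_le hf x xmin
  have h3 : f xmin ≤ f y := hmin (Set.mem_univ y)
  have h4 : regularizedModel p L f x y ≤ regularizedModel p L f x xmin := hy (Set.mem_univ xmin)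
  have hp1 : (1 : ℝ) ≤ p := by exact_mod_cast hp
  have hc : 0 < L / (Nat.factorial (p + 1) : ℝ) := by positivity
  have h5 : (L / (Nat.factorial (p + 1) : ℝ)) * (p * ‖y - x‖ ^ (p + 1)) ≤
      (L / (Nat.factorial (p + 1) : ℝ)) * ((p + 2) * ‖xmin - x‖ ^ (p + 1)) := by
    have e1 : (L / (Nat.factorial (p + 1) : ℝ)) * (p * ‖y - x‖ ^ (p + 1)) =
      p * L / (Nat.factorial (p + 1) : ℝ) * ‖y - x‖ ^ (p + 1) := by ring
    have e2 : (L / (Nat.factorial (p + 1) : ℝ)) * ((p + 2) * ‖xmin - x‖ ^ (p + 1)) =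
      (p + 2) * L / (Nat.factorial (p + 1) : ℝ) * ‖xmin - x‖ ^ (p + 1) := by ring
    rw [e1, e2]; linarith
  have h6 := le_of_mul_le_mul_left h5 hc
  rw [norm_sub_rev xmin x] at h6
  -- For `p ≥ 1`, `p + 2 ≤ 4 p ≤ 2 ^ (p + 1) p`, which gives the factor `2` after taking roots.
  have h7 : (4 : ℝ) ≤ 2 ^ (p + 1) := by
    calc (4 : ℝ) = 2 ^ 2 := by norm_num
      _ ≤ _ := pow_le_pow_right₀ (by norm_num) (by omega)
  refine le_of_pow_le_pow_left₀ (n := p + 1) (by omega) (by positivity) ?_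
  rw [mul_pow]
  have h8 : 0 ≤ ‖x - xmin‖ ^ (p + 1) := by positivity
  have h9 : (p : ℝ) * ‖y - x‖ ^ (p + 1) ≤ p * (2 ^ (p + 1) * ‖x - xmin‖ ^ (p + 1)) := by
    nlinarith [mul_le_mul_of_nonneg_right h7 h8]
  exact le_of_mul_le_mul_left h9 (by linarith)

end Model

/-! ### Uniform convexity of the model and stability of its minimizer. -/

section UniformConvexity

variable {d p : ℕ} {L : ℝ} {f : Vec d → ℝ}

/-- The second derivative of `f_p` along `e` is the Taylor expansion of order `p - 2` of `∂_e ∂_e f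
≥ 0`, so it is nonnegative up to the remainder. -/
lemma HasLipschitzDeriv.le_fderiv_fderiv_taylorExpansion (hp : 2 ≤ p)
    (hf : HasLipschitzDeriv p L f) (hc : ConvexOn ℝ Set.univ f) (x w e : Vec d) :
    -(L / (Nat.factorial (p - 1) : ℝ) * ‖w - x‖ ^ (p - 1) * ‖e‖ ^ 2) ≤
      fderiv ℝ (fun y => fderiv ℝ (taylorExpansion p f x) y e) w e := by
  obtain ⟨q, rfl⟩ : ∃ q, p = q + 2 := ⟨p - 2, by omega⟩
  have h1 : (fun y => fderiv ℝ (taylorExpansion (q + 2) f x) y e) =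
      taylorExpansion (q + 1) (fun y => fderiv ℝ f y e) x :=
    funext fun y => fderiv_taylorExpansion hf.1 x y e
  have hfe := hf.fderiv_apply e
  rw [h1, fderiv_taylorExpansion hfe.1]
  have h2 := (hfe.fderiv_apply e).abs_sub_taylorExpansion_le x (w - x)
  rw [add_sub_cancel] at h2
  have h3 := hc.fderiv_fderiv_nonneg (hf.1.of_le (by norm_cast)) w e
  have h4 := (abs_le.1 h2).2
  have h5 : L * ‖e‖ * ‖e‖ / (Nat.factorial (q + 1) : ℝ) * ‖w - x‖ ^ (q + 1) =
    L / (Nat.factorial (q + 2 - 1) : ℝ) * ‖w - x‖ ^ (q + 2 - 1) * ‖e‖ ^ 2 := by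
    rw [show q + 2 - 1 = q + 1 by omega]; ring
  linarith

/-- A smooth version of the convexity of the Taylor expansion plus a power of the norm. -/
lemma convexOn_taylorExpansion_line (hp : 2 ≤ p) (hL : 0 < L)
    (hf : HasLipschitzDeriv p L f) (hc : ConvexOn ℝ Set.univ f) (x a e : Vec d) {η : ℝ}
    (hη : 0 < η) :
    ConvexOn ℝ Set.univ (fun t : ℝ => taylorExpansion p f x (a + t • e) +
      p * L / (Nat.factorial (p + 1) : ℝ) *
        (‖a + t • e - x‖ ^ 2 + η) ^ (((p : ℝ) + 1) / 2)) := by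
  set s : ℝ := ((p : ℝ) + 1) / 2 with hs
  set c : ℝ := p * L / (Nat.factorial (p + 1) : ℝ) with hcdef
  have hp2 : (2 : ℝ) ≤ p := by exact_mod_cast hp
  have hc0 : 0 < c := by positivity
  set T := taylorExpansion p f x with hT
  have hψ : ∀ t : ℝ, HasDerivAt (fun t : ℝ => ‖a + t • e - x‖ ^ 2 + η)
      (2 * inner ℝ (a + t • e - x) e) t := by
    intro t
    have h1 : HasDerivAt (fun t : ℝ => a + t • e - x) e t := by
      simpa using (((hasDerivAt_id t).smul_const e).const_add a).sub_const x
    exact h1.norm_sq.add_const η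
  have hψ' : ∀ t : ℝ, HasDerivAt (fun t : ℝ => 2 * inner ℝ (a + t • e - x) e)
      (2 * ‖e‖ ^ 2) t := by
    intro t
    have h1 : HasDerivAt (fun t : ℝ => a + t • e - x) e t := by
      simpa using (((hasDerivAt_id t).smul_const e).const_add a).sub_const x
    have h2 := (h1.inner ℝ (hasDerivAt_const t e)).const_mul 2
    simpa [real_inner_self_eq_norm_sq] using h2
  have hψpos : ∀ t : ℝ, 0 < ‖a + t • e - x‖ ^ 2 + η := fun t => by positivity
  have hTd : ∀ t : ℝ, HasDerivAt (fun t : ℝ => T (a + t • e)) (fderiv ℝ T (a + t • e) e) t :=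
    fun t => hasDerivAt_comp_line ((differentiable_taylorExpansion hf.1 x) _).hasFDerivAt
  have hTd2 : ∀ t : ℝ, HasDerivAt (fun t : ℝ => fderiv ℝ T (a + t • e) e)
      (fderiv ℝ (fun y => fderiv ℝ T y e) (a + t • e) e) t := by
    intro t
    have h : Differentiable ℝ (fun y => fderiv ℝ T y e) := by
      obtain ⟨q, rfl⟩ : ∃ q, p = q + 1 := ⟨p - 1, by omega⟩
      rw [funext fun y => fderiv_taylorExpansion hf.1 x y e]
      exact differentiable_taylorExpansion (hf.fderiv_apply e).1 x
    exact hasDerivAt_comp_line (g := fun y => fderiv ℝ T y e) (h _).hasFDerivAt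
  -- The shift `η > 0` keeps the base of the real power positive, hence differentiable twice also
  -- where the line meets `x`.
  refine convexOn_of_hasDerivWithinAt2_nonneg (D := Set.univ) convex_univ
    (fun t _ => ?_) (fun t _ => ((hTd t).add
      (((hψ t).rpow_const (p := s) (Or.inl (hψpos t).ne')).const_mul c)).hasDerivWithinAt)
    (fun t _ => ((hTd2 t).add (((((hψ' t).mul_const s).mul
      ((hψ t).rpow_const (p := s - 1) (Or.inl (hψpos t).ne'))))
        |>.const_mul c)).hasDerivWithinAt) (fun t _ => ?_)
  · exact ((hTd t).add (((hψ t).rpow_const (p := s)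
      (Or.inl (hψpos t).ne')).const_mul c)).continuousAt.continuousWithinAt
  · have h1 := hf.le_fderiv_fderiv_taylorExpansion hp hc x (a + t • e) e
    set N := ‖a + t • e - x‖ with hN
    set I := inner ℝ (a + t • e - x) e with hI
    have hN0 : 0 ≤ N := norm_nonneg _
    have h2 : N ^ (p - 1) ≤ (N ^ 2 + η) ^ (s - 1) := by
      have e1 : N ^ (p - 1) = (N ^ 2) ^ (s - 1) := by
        rw [← Real.rpow_natCast N 2, ← Real.rpow_mul hN0, ← Real.rpow_natCast]
        congr 1
        rw [Nat.cast_sub (by omega), hs]; push_cast; ring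
      rw [e1]
      exact Real.rpow_le_rpow (by positivity) (by linarith) (by rw [hs]; linarith)
    have h3 : 0 ≤ (N ^ 2 + η) ^ (s - 1 - 1) := (Real.rpow_pos_of_pos (hψpos t) _).le
    -- The weight `c` is exactly what compensates the negative curvature allowed for `f_p`.
    have h4 : c * (2 * s) = L / (Nat.factorial (p - 1) : ℝ) := by
      rw [hcdef, hs, Nat.factorial_succ, Nat.cast_mul, factorial_eq_mul_pred (by omega)]
      push_cast
      field_simp
    have hs1 : 0 ≤ s * (s - 1) := by rw [hs]; nlinarith
    have h5 : 0 ≤ c * (s * (s - 1) * (2 * I) ^ 2 * (N ^ 2 + η) ^ (s - 1 - 1)) := by positivity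
    have h6 : L / (Nat.factorial (p - 1) : ℝ) * N ^ (p - 1) * ‖e‖ ^ 2 ≤
        L / (Nat.factorial (p - 1) : ℝ) * (N ^ 2 + η) ^ (s - 1) * ‖e‖ ^ 2 := by gcongr
    have h7 : c * (2 * ‖e‖ ^ 2 * s * (N ^ 2 + η) ^ (s - 1) +
        2 * I * s * (2 * I * (s - 1) * (N ^ 2 + η) ^ (s - 1 - 1))) =
        c * (2 * s) * (N ^ 2 + η) ^ (s - 1) * ‖e‖ ^ 2 +
        c * (s * (s - 1) * (2 * I) ^ 2 * (N ^ 2 + η) ^ (s - 1 - 1)) := by ring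
    rw [h7, h4]
    linarith

/-- Limit `η → 0` of the smoothed convexity; midpoints suffice later. -/
lemma taylorExpansion_add_norm_pow_midpoint_le (hp : 2 ≤ p) (hL : 0 < L)
    (hf : HasLipschitzDeriv p L f) (hc : ConvexOn ℝ Set.univ f) (x a b : Vec d) :
    taylorExpansion p f x ((1 / 2 : ℝ) • (a + b)) + p * L / (Nat.factorial (p + 1) : ℝ) *
        ‖(1 / 2 : ℝ) • (a + b) - x‖ ^ (p + 1) ≤
      (taylorExpansion p f x a + p * L / (Nat.factorial (p + 1) : ℝ) * ‖a - x‖ ^ (p + 1)) / 2 +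
      (taylorExpansion p f x b + p * L / (Nat.factorial (p + 1) : ℝ) * ‖b - x‖ ^ (p + 1)) / 2 := by
  set c : ℝ := p * L / (Nat.factorial (p + 1) : ℝ) with hcdef
  set s : ℝ := ((p : ℝ) + 1) / 2 with hs
  have hs0 : 0 < s := by positivity
  have hlim : ∀ w : Vec d, Filter.Tendsto
      (fun η : ℝ => taylorExpansion p f x w + c * (‖w - x‖ ^ 2 + η) ^ s)
      (nhdsWithin 0 (Set.Ioi 0)) (nhds (taylorExpansion p f x w + c * ‖w - x‖ ^ (p + 1))) := by
    intro w
    have h1 : Continuous (fun η : ℝ => taylorExpansion p f x w + c * (‖w - x‖ ^ 2 + η) ^ s) :=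
      continuous_const.add (continuous_const.mul
        ((continuous_const.add continuous_id).rpow_const fun _ => Or.inr hs0.le))
    have h2 := (h1.tendsto 0).mono_left (nhdsWithin_le_nhds (s := Set.Ioi 0))
    have h3 : (‖w - x‖ ^ 2 + 0) ^ s = ‖w - x‖ ^ (p + 1) := by
      rw [add_zero, ← Real.rpow_natCast _ 2, ← Real.rpow_mul (norm_nonneg _), ← Real.rpow_natCast]
      congr 1
      rw [hs]; push_cast; ring
    rwa [h3] at h2
  refine le_of_tendsto_of_tendsto (hlim _) (((hlim a).div_const 2).add ((hlim b).div_const 2)) ?_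
  filter_upwards [self_mem_nhdsWithin] with η hη
  have h := (convexOn_taylorExpansion_line hp hL hf hc x a (b - a) hη).2
    (Set.mem_univ 0) (Set.mem_univ 1) (by norm_num : (0 : ℝ) ≤ 1 / 2)
    (by norm_num : (0 : ℝ) ≤ 1 / 2) (by norm_num)
  have e1 : a + ((1 / 2 : ℝ) • (0 : ℝ) + (1 / 2 : ℝ) • (1 : ℝ)) • (b - a) =
      (1 / 2 : ℝ) • (a + b) := by
    simp only [smul_eq_mul]; module
  have e2 : a + (1 : ℝ) • (b - a) = b := by module
  have e3 : a + (0 : ℝ) • (b - a) = a := by module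
  simp only [e1, e2, e3] at h
  refine h.trans (le_of_eq ?_)
  simp only [smul_eq_mul]
  ring

/-- Clarkson's inequality in an inner product space. -/
lemma norm_pow_midpoint_add_le {n : ℕ} (hn : 2 ≤ n) (u v : Vec d) :
    ‖(1 / 2 : ℝ) • (u + v)‖ ^ n + ‖(1 / 2 : ℝ) • (u - v)‖ ^ n ≤ (‖u‖ ^ n + ‖v‖ ^ n) / 2 := by
  set s : ℝ := (n : ℝ) / 2 with hs
  have hs1 : 1 ≤ s := by
    have : (2 : ℝ) ≤ n := by exact_mod_cast hn
    rw [hs]; linarith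
  have hpow : ∀ w : Vec d, ‖w‖ ^ n = (‖w‖ ^ 2) ^ s := by
    intro w
    rw [← Real.rpow_natCast _ 2, ← Real.rpow_mul (norm_nonneg _), ← Real.rpow_natCast]
    congr 1
    rw [hs]; push_cast; ring
  simp only [hpow]
  have h1 : ‖(1 / 2 : ℝ) • (u + v)‖ ^ 2 + ‖(1 / 2 : ℝ) • (u - v)‖ ^ 2 =
      (1 / 2 : ℝ) * ‖u‖ ^ 2 + (1 / 2 : ℝ) * ‖v‖ ^ 2 := by
    rw [norm_smul, norm_smul, mul_pow, mul_pow, ← mul_add]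
    have := parallelogram_law_with_norm ℝ u v
    rw [show ‖u + v‖ ^ 2 + ‖u - v‖ ^ 2 = 2 * (‖u‖ * ‖u‖ + ‖v‖ * ‖v‖) by linarith]
    norm_num
    ring
  -- Superadditivity of `t ↦ t ^ s`, the parallelogram law, then convexity of `t ↦ t ^ s`.
  calc _ ≤ (‖(1 / 2 : ℝ) • (u + v)‖ ^ 2 + ‖(1 / 2 : ℝ) • (u - v)‖ ^ 2) ^ s :=
        Real.add_rpow_le_rpow_add (by positivity) (by positivity) hs1
    _ = ((1 / 2 : ℝ) * ‖u‖ ^ 2 + (1 / 2 : ℝ) * ‖v‖ ^ 2) ^ s := by rw [h1]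
    _ ≤ (1 / 2 : ℝ) * (‖u‖ ^ 2) ^ s + (1 / 2 : ℝ) * (‖v‖ ^ 2) ^ s := by
        have := (convexOn_rpow hs1).2 (Set.mem_Ici.2 (sq_nonneg ‖u‖))
          (Set.mem_Ici.2 (sq_nonneg ‖v‖)) (by norm_num : (0 : ℝ) ≤ 1 / 2)
          (by norm_num : (0 : ℝ) ≤ 1 / 2) (by norm_num)
        simpa using this
    _ = _ := by ring

/-- Of the `p + 1` shares of the regularizer, `p` make the Taylor part convex and the last one
provides uniform convexity. -/
lemma regularizedModel_eq (x w : Vec d) : regularizedModel p L f x w =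
    (taylorExpansion p f x w + p * L / (Nat.factorial (p + 1) : ℝ) * ‖w - x‖ ^ (p + 1)) +
      L / (Nat.factorial (p + 1) : ℝ) * ‖w - x‖ ^ (p + 1) := by
  unfold regularizedModel
  have h2 : L / (Nat.factorial p : ℝ) = L / (Nat.factorial (p + 1) : ℝ) * (p + 1) := by
    rw [Nat.factorial_succ]; push_cast; field_simp
  rw [h2]; ring

/-- Uniform convexity of the regularized model at its minimizer. -/
lemma regularizedModel_add_le_of_isMinOn (hp : 2 ≤ p) (hL : 0 < L) (hf : HasLipschitzDeriv p L f)
    (hc : ConvexOn ℝ Set.univ f) {x a : Vec d}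
    (ha : IsMinOn (regularizedModel p L f x) Set.univ a) (b : Vec d) :
    regularizedModel p L f x a +
      2 * (L / (Nat.factorial (p + 1) : ℝ)) * ‖(1 / 2 : ℝ) • (a - b)‖ ^ (p + 1) ≤
      regularizedModel p L f x b := by
  have h1 := taylorExpansion_add_norm_pow_midpoint_le hp hL hf hc x a b
  have h2 := norm_pow_midpoint_add_le (n := p + 1) (by omega) (a - x) (b - x)
  have e1 : (1 / 2 : ℝ) • ((a - x) + (b - x)) = (1 / 2 : ℝ) • (a + b) - x := by module
  rw [e1, sub_sub_sub_cancel_right] at h2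
  have h3 : regularizedModel p L f x a ≤ regularizedModel p L f x ((1 / 2 : ℝ) • (a + b)) :=
    ha (Set.mem_univ _)
  have hc : 0 ≤ L / (Nat.factorial (p + 1) : ℝ) := by positivity
  have h4 := mul_le_mul_of_nonneg_left h2 hc
  rw [regularizedModel_eq x ((1 / 2 : ℝ) • (a + b))] at h3
  have h5 := regularizedModel_eq (p := p) (L := L) (f := f) x a
  have h6 := regularizedModel_eq (p := p) (L := L) (f := f) x b
  nlinarith

lemma abs_pow_succ_sub_pow_succ_le {a b M : ℝ} (n : ℕ) (ha : 0 ≤ a) (hb : 0 ≤ b) (haM : a ≤ M)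
    (hbM : b ≤ M) : |a ^ (n + 1) - b ^ (n + 1)| ≤ (n + 1) * M ^ n * |a - b| := by
  have h := abs_pow_sub_pow_le (a := a) (b := b) (n := n + 1)
  rw [abs_of_nonneg ha, abs_of_nonneg hb] at h
  refine h.trans ?_
  push_cast
  calc |a - b| * (n + 1) * max a b ^ n ≤ |a - b| * (n + 1) * M ^ n := by
        gcongr; exact max_le haM hbM
    _ = _ := by ring

lemma abs_regularizedModel_sub_le (hL : 0 < L) (hf : HasLipschitzDeriv p L f) (x v w : Vec d)
    {M : ℝ} (hM : ‖w - v‖ + ‖x - v‖ ≤ M) :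
    |regularizedModel p L f x w - regularizedModel p L f v w| ≤
      L / (Nat.factorial (p + 1) : ℝ) * ((p + 2) * (p + 1) * M ^ p * ‖x - v‖) := by
  have h1 := hf.abs_taylorExpansion_sub_le x v (w - v)
  rw [add_sub_cancel] at h1
  have h2 := (le_abs_self _).trans (abs_pow_succ_sub_pow_succ_le (a := ‖x - v‖ + ‖w - v‖)
    (b := ‖w - v‖) (M := M) p
    (by positivity) (by positivity) (by linarith) (by linarith [norm_nonneg (x - v)]))
  rw [add_sub_cancel_right, abs_of_nonneg (norm_nonneg _)] at h2
  have h3 : ‖w - x‖ ≤ ‖w - v‖ + ‖x - v‖ := by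
    have : w - x = (w - v) - (x - v) := by abel
    rw [this]; exact norm_sub_le _ _
  have h4 := abs_pow_succ_sub_pow_succ_le (a := ‖w - x‖) (b := ‖w - v‖) (M := M) p
    (by positivity) (by positivity) (by linarith) (by linarith [norm_nonneg (x - v)])
  have h5 : |‖w - x‖ - ‖w - v‖| ≤ ‖x - v‖ := by
    have := abs_norm_sub_norm_le (w - x) (w - v)
    rwa [sub_sub_sub_cancel_left, norm_sub_rev v x] at this
  have hM0 : 0 ≤ M := by linarith [norm_nonneg (w - v), norm_nonneg (x - v)]
  set c := L / (Nat.factorial (p + 1) : ℝ) with hcd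
  have hc : 0 ≤ c := by positivity
  have h6 : L / (Nat.factorial p : ℝ) = c * (p + 1) := by
    rw [hcd, Nat.factorial_succ]; push_cast; field_simp
  unfold regularizedModel
  rw [h6]
  calc _ = |(taylorExpansion p f x w - taylorExpansion p f v w) +
        c * (p + 1) * (‖w - x‖ ^ (p + 1) - ‖w - v‖ ^ (p + 1))| := by congr 1; ring
    _ ≤ |taylorExpansion p f x w - taylorExpansion p f v w| +
        c * (p + 1) * |‖w - x‖ ^ (p + 1) - ‖w - v‖ ^ (p + 1)| := by
      refine (abs_add_le _ _).trans_eq ?_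
      rw [abs_mul, abs_of_nonneg (by positivity : 0 ≤ c * ((p : ℝ) + 1))]
    _ ≤ c * ((p + 1) * M ^ p * ‖x - v‖) + c * (p + 1) * ((p + 1) * M ^ p * ‖x - v‖) := by
      refine add_le_add (h1.trans (mul_le_mul_of_nonneg_left h2 hc)) ?_
      refine mul_le_mul_of_nonneg_left (h4.trans ?_) (by positivity)
      gcongr
    _ = _ := by ring

/-- Hölder stability of the minimizer of the regularized model with respect to its center. -/
lemma norm_sub_pow_le_of_isMinOn_regularizedModel (hp : 2 ≤ p) (hL : 0 < L)
    (hf : HasLipschitzDeriv p L f) (hc : ConvexOn ℝ Set.univ f) {x v a b : Vec d}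
    (ha : IsMinOn (regularizedModel p L f x) Set.univ a)
    (hb : IsMinOn (regularizedModel p L f v) Set.univ b) {M : ℝ}
    (hMa : ‖a - x‖ + ‖x - v‖ ≤ M) (hMb : ‖b - v‖ + ‖x - v‖ ≤ M) :
    2 * (‖a - b‖ / 2) ^ (p + 1) ≤ (p + 2) * (p + 1) * M ^ p * ‖x - v‖ := by
  -- Adding both growth inequalities leaves only the differences of the two models at `a` and at
  -- `b`.
  have h1 := regularizedModel_add_le_of_isMinOn hp hL hf hc ha b
  have h2 := regularizedModel_add_le_of_isMinOn hp hL hf hc hb a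
  have h3 := (abs_le.1 (abs_regularizedModel_sub_le hL hf x v b hMb)).2
  have h4 := (abs_le.1 (abs_regularizedModel_sub_le hL hf v x a
    (M := M) (by rwa [norm_sub_rev v x]))).2
  have e1 : ‖(1 / 2 : ℝ) • (a - b)‖ = ‖a - b‖ / 2 := by rw [norm_smul]; norm_num; ring
  have e2 : ‖(1 / 2 : ℝ) • (b - a)‖ = ‖a - b‖ / 2 := by
    rw [norm_smul, norm_sub_rev]; norm_num; ring
  rw [e1] at h1
  rw [e2] at h2
  rw [norm_sub_rev v x] at h4
  have hc : 0 < L / (Nat.factorial (p + 1) : ℝ) := by positivity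
  refine le_of_mul_le_mul_left ?_ hc
  linarith

end UniformConvexity

/-! ### The quadratic equation defining the weights. -/

section StepWeight

variable {d : ℕ} {A lam : ℝ}

lemma stepWeight_pos (hA : 0 ≤ A) (hlam : 0 < lam) : 0 < stepWeight A lam := by
  unfold stepWeight; positivity

lemma stepWeight_sq (hA : 0 ≤ A) (hlam : 0 < lam) :
    stepWeight A lam ^ 2 = lam * (A + stepWeight A lam) := by
  unfold stepWeight
  have := Real.sq_sqrt (show 0 ≤ lam ^ 2 + 4 * lam * A by positivity)
  nlinarith

lemma le_stepWeight (hA : 0 ≤ A) (hlam : 0 < lam) : lam ≤ stepWeight A lam := by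
  unfold stepWeight
  have : lam ≤ Real.sqrt (lam ^ 2 + 4 * lam * A) := by
    apply Real.le_sqrt_of_sq_le
    have : 0 ≤ lam * A := by positivity
    nlinarith
  linarith

lemma smul_extrapolation (hA : 0 ≤ A) (hlam : 0 < lam) (x y : Vec d) :
    (A + stepWeight A lam) • extrapolation A x y lam = A • y + stepWeight A lam • x := by
  have : A + stepWeight A lam ≠ 0 := by linarith [stepWeight_pos hA hlam] |> ne_of_gt
  unfold extrapolation
  rw [smul_add, smul_smul, smul_smul, mul_div_cancel₀ _ this, mul_div_cancel₀ _ this]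

end StepWeight

/-! ### Lyapunov function and a priori bounds on the iterates. -/

section Energy

variable {d p : ℕ} {L : ℝ} {f : Vec d → ℝ} {xmin : Vec d}

/-- Decrease of the Lyapunov function along one step. -/
lemma IsATDStep.energy_le (hp : 1 ≤ p) (hL : 0 < L) (hf : HasLipschitzDeriv p L f)
    (hc : ConvexOn ℝ Set.univ f) {A lam : ℝ} (hA : 0 ≤ A) {x y y' : Vec d}
    (h : IsATDStep p L f A x y lam y') (z : Vec d) :
    (A + stepWeight A lam) * (f y' - f z) +
      1 / 2 * ‖x - stepWeight A lam • gradient f y' - z‖ ^ 2 +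
      3 / 8 * ((A + stepWeight A lam) / lam * ‖y' - extrapolation A x y lam‖ ^ 2) ≤
      A * (f y - f z) + 1 / 2 * ‖x - z‖ ^ 2 := by
  obtain ⟨hlam, h1, h2, hmin⟩ := h
  have ha := stepWeight_pos hA hlam
  have ha2 := stepWeight_sq hA hlam
  have hxt := smul_extrapolation hA hlam x y
  have hn := norm_smul_gradient_add_le hp hL hf hmin hlam h1 h2
  set a := stepWeight A lam
  set xt := extrapolation A x y lam
  set g := gradient f y' with hg
  have hn2 : ‖lam • g + (y' - xt)‖ ^ 2 ≤ ‖y' - xt‖ ^ 2 / 4 := by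
    have := pow_le_pow_left₀ (norm_nonneg _) hn 2
    linarith [this, show (‖y' - xt‖ / 2) ^ 2 = ‖y' - xt‖ ^ 2 / 4 by ring]
  rw [norm_add_sq_real, norm_smul, real_inner_smul_left, mul_pow, Real.norm_eq_abs, sq_abs] at hn2
  have hd := hf.differentiable hp y'
  have hz := hc.add_fderiv_le hd z
  have hy := hc.add_fderiv_le hd y
  rw [← inner_gradient_eq_fderiv, ← hg] at hz hy
  have e0 : x - a • g - z = (x - z) - a • g := by abel
  rw [e0, norm_sub_sq_real, norm_smul, mul_pow, Real.norm_eq_abs, sq_abs, real_inner_smul_right]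
  -- Since `(A + a) x̃ = A y + a x`, this inner product splits into the linearizations of `f` at
  -- `y'` towards `y` and `z` and the cross term of `‖x - a g - z‖²`.
  have e1 : (A + a) * inner ℝ g (y' - xt) =
      -(A * inner ℝ g (y - y')) - a * inner ℝ g (z - y') - a * inner ℝ (x - z) g := by
    rw [real_inner_comm g (x - z), ← real_inner_smul_right, smul_sub, hxt]
    simp only [inner_sub_right, inner_add_right, real_inner_smul_right]
    ring
  have e2 : (A + a) / lam * ‖y' - xt‖ ^ 2 * lam = (A + a) * ‖y' - xt‖ ^ 2 := by
    field_simp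
  have h3 := mul_le_mul_of_nonneg_left hy hA
  have h4 := mul_le_mul_of_nonneg_left hz ha.le
  -- The factor turns `λ² ‖g‖²` into `a² ‖g‖²`; the final `3/8` is half of `1 - 1/4`.
  have h5 : (A + a) / lam * (lam ^ 2 * ‖g‖ ^ 2 + 2 * (lam * inner ℝ g (y' - xt)) +
      ‖y' - xt‖ ^ 2) ≤ (A + a) / lam * (‖y' - xt‖ ^ 2 / 4) :=
    mul_le_mul_of_nonneg_left hn2 (by positivity)
  have e3 : (A + a) / lam * (lam ^ 2 * ‖g‖ ^ 2 + 2 * (lam * inner ℝ g (y' - xt)) +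
      ‖y' - xt‖ ^ 2) = a ^ 2 * ‖g‖ ^ 2 + 2 * ((A + a) * inner ℝ g (y' - xt)) +
      (A + a) / lam * ‖y' - xt‖ ^ 2 := by
    rw [ha2]; field_simp
  rw [e3, e1] at h5
  linarith

variable {K : ℕ} {lam A : ℕ → ℝ} {x y : ℕ → Vec d}

lemma IsATDRun.weight_nonneg (h : IsATDRun p L f K lam A x y) : ∀ k ≤ K, 0 ≤ A k := by
  intro k
  induction k with
  | zero => intro _; rw [h.A_zero]
  | succ k ih =>
    intro hk
    rw [h.A_succ k hk]
    have := ih (by omega)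
    linarith [stepWeight_pos this (h.step k hk).1]

lemma IsATDRun.lam_le_weight (h : IsATDRun p L f K lam A x y) (k : ℕ) (hk : k + 1 ≤ K) :
    lam 1 ≤ A (k + 1) := by
  induction k with
  | zero =>
    rw [h.A_succ 0 hk]
    have := h.weight_nonneg 0 (by omega)
    linarith [le_stepWeight this (h.step 0 hk).1]
  | succ k ih =>
    have h1 := ih (by omega)
    rw [h.A_succ (k + 1) hk]
    linarith [stepWeight_pos (h.weight_nonneg (k + 1) (by omega)) (h.step (k + 1) hk).1]

lemma IsATDRun.weight_pos (h : IsATDRun p L f K lam A x y) {k : ℕ} (hk1 : 1 ≤ k) (hk : k ≤ K) :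
    0 < A k := by
  obtain ⟨j, rfl⟩ : ∃ j, k = j + 1 := ⟨k - 1, by omega⟩
  exact (h.step 0 (by omega)).1.trans_le (h.lam_le_weight j hk)

lemma IsATDRun.energy_le (hp : 1 ≤ p) (hL : 0 < L) (hf : HasLipschitzDeriv p L f)
    (hc : ConvexOn ℝ Set.univ f) (h : IsATDRun p L f K lam A x y) (z : Vec d) :
    ∀ k ≤ K, A k * (f (y k) - f z) + 1 / 2 * ‖x k - z‖ ^ 2 +
      3 / 8 * ∑ i ∈ Finset.range k, A (i + 1) / lam (i + 1) *
        ‖y (i + 1) - extrapolation (A i) (x i) (y i) (lam (i + 1))‖ ^ 2 ≤ 1 / 2 * ‖z‖ ^ 2 := by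
  intro k
  induction k with
  | zero => intro _; simp [h.A_zero, h.x_zero]
  | succ k ih =>
    intro hk
    have h1 := ih (by omega)
    have h2 := (h.step k hk).energy_le hp hL hf hc (h.weight_nonneg k (by omega)) z
    rw [← h.x_succ k hk, ← h.A_succ k hk] at h2
    rw [Finset.sum_range_succ]
    linarith

lemma IsATDRun.norm_x_sub_le (hp : 1 ≤ p) (hL : 0 < L) (hf : HasLipschitzDeriv p L f)
    (hc : ConvexOn ℝ Set.univ f) (hmin : IsMinOn f Set.univ xmin)
    (h : IsATDRun p L f K lam A x y) {k : ℕ} (hk : k ≤ K) : ‖x k - xmin‖ ≤ ‖xmin‖ := by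
  have h1 := h.energy_le hp hL hf hc xmin k hk
  have h2 : f xmin ≤ f (y k) := hmin (Set.mem_univ _)
  have h3 := mul_nonneg (h.weight_nonneg k hk) (sub_nonneg.2 h2)
  have h4 : 0 ≤ ∑ i ∈ Finset.range k, A (i + 1) / lam (i + 1) *
        ‖y (i + 1) - extrapolation (A i) (x i) (y i) (lam (i + 1))‖ ^ 2 :=
    Finset.sum_nonneg fun i hi => by
      have hi' := Finset.mem_range.1 hi
      have := h.weight_nonneg (i + 1) (by omega)
      have := (h.step i (by omega)).1
      positivity
  exact le_of_sq_le_sq (by linarith) (norm_nonneg _)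

/-- The energy dissipation, rewritten by `a² = λ A_{i+1}`; the sharper constant `4/3` is relaxed to
`4`. -/
lemma IsATDRun.sum_le (hp : 1 ≤ p) (hL : 0 < L) (hf : HasLipschitzDeriv p L f)
    (hc : ConvexOn ℝ Set.univ f) (hmin : IsMinOn f Set.univ xmin)
    (h : IsATDRun p L f K lam A x y) {k : ℕ} (hk : k ≤ K) :
    ∑ i ∈ Finset.range k, (A (i + 1) *
        ‖y (i + 1) - extrapolation (A i) (x i) (y i) (lam (i + 1))‖ /
          stepWeight (A i) (lam (i + 1))) ^ 2 ≤ (2 * ‖xmin‖) ^ 2 := by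
  have h1 := h.energy_le hp hL hf hc xmin k hk
  have h2 : f xmin ≤ f (y k) := hmin (Set.mem_univ _)
  have h3 := mul_nonneg (h.weight_nonneg k hk) (sub_nonneg.2 h2)
  have h4 : ∑ i ∈ Finset.range k, (A (i + 1) *
        ‖y (i + 1) - extrapolation (A i) (x i) (y i) (lam (i + 1))‖ /
          stepWeight (A i) (lam (i + 1))) ^ 2 =
      ∑ i ∈ Finset.range k, A (i + 1) / lam (i + 1) *
        ‖y (i + 1) - extrapolation (A i) (x i) (y i) (lam (i + 1))‖ ^ 2 := by
    refine Finset.sum_congr rfl fun i hi => ?_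
    have hi' := Finset.mem_range.1 hi
    have hA := h.weight_pos (k := i + 1) (by omega) (by omega)
    have hl := (h.step i (by omega)).1
    rw [div_pow, mul_pow, stepWeight_sq (h.weight_nonneg i (by omega)) hl,
      ← h.A_succ i (by omega)]
    field_simp
  rw [h4]
  nlinarith [sq_nonneg ‖x k - xmin‖, sq_nonneg ‖xmin‖]

lemma IsATDRun.norm_y_sub_le (hp : 1 ≤ p) (hL : 0 < L) (hf : HasLipschitzDeriv p L f)
    (hc : ConvexOn ℝ Set.univ f) (hmin : IsMinOn f Set.univ xmin)
    (h : IsATDRun p L f K lam A x y) : ∀ k ≤ K, ‖y k - xmin‖ ≤ 3 * ‖xmin‖ := by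
  intro k
  induction k with
  | zero =>
    intro _
    rw [h.y_zero, zero_sub, norm_neg]
    linarith [norm_nonneg xmin]
  | succ k ih =>
    intro hk
    have hy := ih (by omega)
    have hx := h.norm_x_sub_le hp hL hf hc hmin (k := k) (by omega)
    have hs := h.sum_le hp hL hf hc hmin hk
    rw [Finset.sum_range_succ] at hs
    have hs' := (le_add_of_nonneg_left (Finset.sum_nonneg fun i _ => sq_nonneg _)).trans hs
    have hA := h.weight_nonneg k (by omega)
    have hl := (h.step k hk).1
    have ha := stepWeight_pos hA hl
    have hA' := h.weight_pos (k := k + 1) (by omega) hk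
    have hxt := smul_extrapolation hA hl (x k) (y k)
    rw [h.A_succ k hk] at hs' hA'
    set a := stepWeight (A k) (lam (k + 1))
    set xt := extrapolation (A k) (x k) (y k) (lam (k + 1))
    have h1 := le_of_sq_le_sq hs' (by positivity)
    rw [div_le_iff₀ ha] at h1
    have h2 : (A k + a) * ‖y (k + 1) - xmin‖ ≤
        (A k + a) * ‖y (k + 1) - xt‖ + (A k * ‖y k - xmin‖ + a * ‖x k - xmin‖) := by
      have e : (A k + a) • (y (k + 1) - xmin) =
          (A k + a) • (y (k + 1) - xt) + (A k • (y k - xmin) + a • (x k - xmin)) := by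
        rw [smul_sub, smul_sub, hxt]; module
      have h3 := congrArg norm e
      rw [norm_smul, Real.norm_of_nonneg hA'.le] at h3
      rw [h3]
      refine (norm_add_le _ _).trans ?_
      rw [norm_smul, Real.norm_of_nonneg hA'.le]
      gcongr
      refine (norm_add_le _ _).trans ?_
      rw [norm_smul, norm_smul, Real.norm_of_nonneg hA, Real.norm_of_nonneg ha.le]
    refine le_of_mul_le_mul_left ?_ hA'
    -- With `R = ‖x*‖`: `2 a R` from the step, `a R` from `x_k` and `3 A R` from `y_k` add up to `3
    -- (A + a) R`.
    nlinarith [mul_le_mul_of_nonneg_left hy hA, mul_le_mul_of_nonneg_left hx ha.le]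

lemma IsATDRun.weight_mul_sub_le (hp : 1 ≤ p) (hL : 0 < L) (hf : HasLipschitzDeriv p L f)
    (hc : ConvexOn ℝ Set.univ f) (h : IsATDRun p L f K lam A x y) (z : Vec d) {k : ℕ}
    (hk : k ≤ K) : A k * (f (y k) - f z) ≤ 1 / 2 * ‖z‖ ^ 2 := by
  have h1 := h.energy_le hp hL hf hc z k hk
  have h4 : 0 ≤ ∑ i ∈ Finset.range k, A (i + 1) / lam (i + 1) *
        ‖y (i + 1) - extrapolation (A i) (x i) (y i) (lam (i + 1))‖ ^ 2 :=
    Finset.sum_nonneg fun i hi => by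
      have hi' := Finset.mem_range.1 hi
      have := h.weight_nonneg (i + 1) (by omega)
      have := (h.step i (by omega)).1
      positivity
  nlinarith [sq_nonneg ‖x k - z‖]

/-- Every later weight is at least `λ_1`, and the first step starts at `0`, so its length is at most
`2 ‖x*‖`; admissibility then bounds `λ_1` from below. -/
lemma IsATDRun.factorial_le (hp : 1 ≤ p) (hL : 0 < L) (hf : HasLipschitzDeriv p L f)
    (hmin : IsMinOn f Set.univ xmin) (h : IsATDRun p L f K lam A x y) {k : ℕ} (hk1 : 1 ≤ k)
    (hk : k ≤ K) : (Nat.factorial (p - 1) : ℝ) ≤ 2 * (A k * L * (2 * ‖xmin‖) ^ (p - 1)) := by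
  obtain ⟨j, rfl⟩ : ∃ j, k = j + 1 := ⟨k - 1, by omega⟩
  have h1 := h.lam_le_weight j hk
  obtain ⟨hl, h2, -, h3⟩ := h.step 0 (by omega)
  have h4 := norm_sub_le_of_isMinOn_regularizedModel hp hL hf hmin h3
  have h5 : extrapolation (A 0) (x 0) (y 0) (lam (0 + 1)) = 0 := by
    simp [extrapolation, h.x_zero, h.y_zero]
  rw [h5] at h2 h4
  rw [zero_sub, norm_neg] at h4
  have hfac : (0 : ℝ) < Nat.factorial (p - 1) := by positivity
  have h6 : lam (0 + 1) * (L * ‖y (0 + 1) - 0‖ ^ (p - 1) / (Nat.factorial (p - 1) : ℝ)) =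
    lam (0 + 1) * L * ‖y (0 + 1) - 0‖ ^ (p - 1) / (Nat.factorial (p - 1) : ℝ) := by ring
  rw [h6, le_div_iff₀ hfac] at h2
  have h7 : lam (0 + 1) * L * ‖y (0 + 1) - 0‖ ^ (p - 1) ≤
      A (j + 1) * L * (2 * ‖xmin‖) ^ (p - 1) := by
    have := h.weight_nonneg (j + 1) hk
    gcongr
  linarith

end Energy

/-! ### Growth of the weights and the convergence rate. -/

section Rate

/-- Concavity of `t ↦ t ^ q`, in Bernoulli form; it makes `IsATDRun.sum_weight_le` telescope. -/
lemma rpow_tangent_le {A a q : ℝ} (hA : 0 ≤ A) (ha : 0 < a) (hq0 : 0 ≤ q) (hq1 : q ≤ 1) :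
    q * (a * (A + a) ^ (q - 1)) ≤ (A + a) ^ q - A ^ q := by
  have hA' : 0 < A + a := by linarith
  have h1 := rpow_one_add_le_one_add_mul_self (s := -(a / (A + a))) (p := q) (by
    have : a / (A + a) ≤ 1 := (div_le_one hA').2 (by linarith)
    linarith) hq0 hq1
  have e1 : 1 + -(a / (A + a)) = A / (A + a) := by field_simp; ring
  rw [e1, Real.div_rpow hA hA'.le, div_le_iff₀ (Real.rpow_pos_of_pos hA' q)] at h1
  have e2 : (A + a) ^ (q - 1) = (A + a) ^ q / (A + a) := by
    rw [Real.rpow_sub_one hA'.ne']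
  rw [e2]
  have e3 : (1 + q * -(a / (A + a))) * (A + a) ^ q =
    (A + a) ^ q - q * (a * ((A + a) ^ q / (A + a))) := by ring
  linarith

/-- Weighted AM-GM for `w i / W` and `(s i / S)²` with weights `(p+1)/m` and `(p-1)/(2m)`, whose sum
is `1` exactly for `m = (3p+1)/2`; summing over `i` bounds `k (G/B)^(1/m)` by `1`. -/
lemma mul_rpow_le_of_sum_le {p k : ℕ} (hp : 1 ≤ p) {G W S : ℝ} (hG : 0 < G) (hW : 0 < W)
    (hS : 0 < S) {w s : ℕ → ℝ} (hw : ∀ i < k, 0 ≤ w i) (hs : ∀ i < k, 0 ≤ s i)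
    (h : ∀ i < k, G ≤ w i ^ (p + 1) * s i ^ (p - 1))
    (hsw : ∑ i ∈ Finset.range k, w i ≤ W) (hss : ∑ i ∈ Finset.range k, s i ^ 2 ≤ S ^ 2) :
    G * (k : ℝ) ^ ((3 * (p : ℝ) + 1) / 2) ≤ W ^ (p + 1) * S ^ (p - 1) := by
  set m : ℝ := (3 * (p : ℝ) + 1) / 2 with hm
  have hp1 : (1 : ℝ) ≤ p := by exact_mod_cast hp
  have hm0 : 0 < m := by rw [hm]; linarith
  set B := W ^ (p + 1) * S ^ (p - 1) with hB
  have hB0 : 0 < B := by positivity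
  have key : ∀ i ∈ Finset.range k, (G / B) ^ (1 / m) ≤
      ((p + 1) / m) * (w i / W) + (((p : ℝ) - 1) / 2 / m) * (s i ^ 2 / S ^ 2) := by
    intro i hi
    have hi' := Finset.mem_range.1 hi
    have hwi : 0 ≤ w i / W := div_nonneg (hw i hi') hW.le
    have hsi : 0 ≤ s i / S := div_nonneg (hs i hi') hS.le
    have h1 := Real.geom_mean_le_arith_mean2_weighted (w₁ := (p + 1) / m)
      (w₂ := ((p : ℝ) - 1) / 2 / m) (p₁ := w i / W) (p₂ := s i ^ 2 / S ^ 2) (by positivity)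
      (div_nonneg (by linarith) hm0.le) hwi (by positivity) (by rw [hm]; field_simp; ring)
    refine le_trans ?_ h1
    have e1 : (w i / W) ^ (((p : ℝ) + 1) / m) = ((w i / W) ^ (p + 1)) ^ (1 / m) := by
      rw [← Real.rpow_natCast, ← Real.rpow_mul hwi]; congr 1; push_cast; ring
    have e2 : (s i ^ 2 / S ^ 2) ^ (((p : ℝ) - 1) / 2 / m) = ((s i / S) ^ (p - 1)) ^ (1 / m) := by
      rw [← div_pow, ← Real.rpow_natCast, ← Real.rpow_natCast, ← Real.rpow_mul hsi,
        ← Real.rpow_mul hsi]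
      congr 1; push_cast [Nat.cast_sub hp]; ring
    rw [e1, e2, ← Real.mul_rpow (by positivity) (by positivity)]
    refine Real.rpow_le_rpow (by positivity) ?_ (by positivity)
    rw [div_pow, div_pow, div_mul_div_comm]
    gcongr
    exact h i hi'
  have h2 := Finset.sum_le_sum key
  rw [Finset.sum_add_distrib, ← Finset.mul_sum, ← Finset.mul_sum, ← Finset.sum_div,
    ← Finset.sum_div, Finset.sum_const, Finset.card_range, nsmul_eq_mul] at h2
  have h3 : (∑ i ∈ Finset.range k, w i) / W ≤ 1 := (div_le_one hW).2 hsw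
  have h4 : (∑ i ∈ Finset.range k, s i ^ 2) / S ^ 2 ≤ 1 := (div_le_one (by positivity)).2 hss
  have h5 : (k : ℝ) * (G / B) ^ (1 / m) ≤ 1 := by
    have e : ((p : ℝ) + 1) / m + ((p : ℝ) - 1) / 2 / m = 1 := by rw [hm]; field_simp; ring
    have := mul_le_mul_of_nonneg_left h3 (show 0 ≤ ((p : ℝ) + 1) / m by positivity)
    have := mul_le_mul_of_nonneg_left h4 (show 0 ≤ ((p : ℝ) - 1) / 2 / m from
      div_nonneg (by linarith) hm0.le)
    linarith
  have h6 := Real.rpow_le_rpow (by positivity) h5 hm0.le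
  rw [Real.one_rpow, Real.mul_rpow (by positivity) (by positivity), ← Real.rpow_mul (by positivity),
    one_div_mul_cancel hm0.ne', Real.rpow_one, ← mul_div_assoc, div_le_one hB0] at h6
  linarith

variable {d p : ℕ} {L : ℝ} {f : Vec d → ℝ} {xmin : Vec d}
variable {K : ℕ} {lam A : ℕ → ℝ} {x y : ℕ → Vec d}

lemma IsATDRun.sum_weight_le (h : IsATDRun p L f K lam A x y) : ∀ k ≤ K,
    ∑ i ∈ Finset.range k, stepWeight (A i) (lam (i + 1)) *
      A (i + 1) ^ (1 / ((p : ℝ) + 1) - 1) ≤ (p + 1) * A k ^ (1 / ((p : ℝ) + 1)) := by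
  intro k
  induction k with
  | zero =>
    intro _
    rw [h.A_zero, Finset.sum_range_zero]; positivity
  | succ k ih =>
    intro hk
    rw [Finset.sum_range_succ]
    have h1 := ih (by omega)
    have hA := h.weight_nonneg k (by omega)
    have h2 := rpow_tangent_le (q := 1 / ((p : ℝ) + 1)) hA (stepWeight_pos hA (h.step k hk).1)
      (by positivity) ((div_le_one (by positivity)).2 (by linarith [Nat.cast_nonneg (α := ℝ) p]))
    rw [← h.A_succ k hk] at h2
    have h3 := mul_le_mul_of_nonneg_left h2 (show (0 : ℝ) ≤ p + 1 by positivity)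
    rw [← mul_assoc, mul_one_div_cancel (by positivity), one_mul] at h3
    linarith

/-- Growth of the weights of Accelerated Taylor Descent. -/
lemma IsATDRun.growth (hp : 1 ≤ p) (hL : 0 < L) (hf : HasLipschitzDeriv p L f)
    (hc : ConvexOn ℝ Set.univ f) (hmin : IsMinOn f Set.univ xmin) (hx0 : xmin ≠ 0)
    (h : IsATDRun p L f K lam A x y) {k : ℕ} (hk1 : 1 ≤ k) (hk : k ≤ K) :
    (Nat.factorial (p - 1) : ℝ) / (2 * L) * (k : ℝ) ^ ((3 * (p : ℝ) + 1) / 2) ≤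
      ((p : ℝ) + 1) ^ (p + 1) * A k * (2 * ‖xmin‖) ^ (p - 1) := by
  have hAk := h.weight_pos hk1 hk
  have hR : 0 < ‖xmin‖ := norm_pos_iff.2 hx0
  have key := mul_rpow_le_of_sum_le (k := k) hp (G := (Nat.factorial (p - 1) : ℝ) / (2 * L))
    (W := (p + 1) * A k ^ (1 / ((p : ℝ) + 1))) (S := 2 * ‖xmin‖)
    (w := fun i => stepWeight (A i) (lam (i + 1)) * A (i + 1) ^ (1 / ((p : ℝ) + 1) - 1))
    (s := fun i => A (i + 1) * ‖y (i + 1) - extrapolation (A i) (x i) (y i) (lam (i + 1))‖ /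
          stepWeight (A i) (lam (i + 1))) (by positivity) (by positivity) (by positivity)
    (fun i hi => ?_) (fun i hi => ?_) (fun i hi => ?_) (h.sum_weight_le k hk)
    (h.sum_le hp hL hf hc hmin hk)
  · rwa [mul_pow, ← Real.rpow_mul_natCast hAk.le, Nat.cast_add, Nat.cast_one,
      one_div_mul_cancel (by positivity), Real.rpow_one] at key
  · have := (stepWeight_pos (h.weight_nonneg i (by omega)) (h.step i (by omega)).1).le
    have := h.weight_nonneg (i + 1) (by omega)
    positivity
  · have := (stepWeight_pos (h.weight_nonneg i (by omega)) (h.step i (by omega)).1).le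
    have := h.weight_nonneg (i + 1) (by omega)
    positivity
  · have hA := h.weight_nonneg i (by omega)
    have hA' := h.weight_pos (k := i + 1) (by omega) (by omega)
    obtain ⟨hl, h2, -, -⟩ := h.step i (by omega)
    have ha := stepWeight_pos hA hl
    have ha2 := stepWeight_sq hA hl
    rw [← h.A_succ i (by omega)] at ha2
    set a := stepWeight (A i) (lam (i + 1))
    set r := ‖y (i + 1) - extrapolation (A i) (x i) (y i) (lam (i + 1))‖
    have e1 : (a * A (i + 1) ^ (1 / ((p : ℝ) + 1) - 1)) ^ (p + 1) = a ^ (p + 1) / A (i + 1) ^ p := by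
      rw [mul_pow, ← Real.rpow_mul_natCast hA'.le, div_eq_mul_inv (a ^ (p + 1)),
        ← Real.rpow_natCast (A (i + 1)) p, ← Real.rpow_neg hA'.le]
      congr 2
      push_cast
      field_simp
      ring
    have e2 : a ^ (p + 1) = a ^ (p - 1) * a ^ 2 := by rw [← pow_add]; congr 1; omega
    have e3 : A (i + 1) ^ p = A (i + 1) ^ (p - 1) * A (i + 1) := by
      rw [← pow_succ, Nat.sub_add_cancel hp]
    -- The exponents in `w` and `s` are chosen so that `a` and `A` cancel through `a² = λ A_{i+1}`.
    have e4 : (a * A (i + 1) ^ (1 / ((p : ℝ) + 1) - 1)) ^ (p + 1) *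
        (A (i + 1) * r / a) ^ (p - 1) = lam (i + 1) * r ^ (p - 1) := by
      rw [e1, e2, e3, ha2, div_pow, mul_pow]
      field_simp
    rw [e4, div_le_iff₀ (by positivity)]
    have hfac : (0 : ℝ) < Nat.factorial (p - 1) := by positivity
    have h6 : lam (i + 1) * (L * r ^ (p - 1) / (Nat.factorial (p - 1) : ℝ)) =
      lam (i + 1) * L * r ^ (p - 1) / (Nat.factorial (p - 1) : ℝ) := by ring
    rw [h6, le_div_iff₀ hfac] at h2
    linarith

theorem IsATDRun.rate (hp : 1 ≤ p) (hL : 0 < L) (hf : HasLipschitzDeriv p L f)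
    (hc : ConvexOn ℝ Set.univ f) (hmin : IsMinOn f Set.univ xmin)
    {k : ℕ} (h : IsATDRun p L f k lam A x y) (hk1 : 1 ≤ k) :
    f (y k) - f xmin ≤
      (2 ^ (p - 1) * ((p : ℝ) + 1) ^ ((3 * (p : ℝ) + 1) / 2) / (Nat.factorial (p - 1) : ℝ)) *
        L * ‖xmin‖ ^ (p + 1) / (k : ℝ) ^ ((3 * (p : ℝ) + 1) / 2) := by
  have hAk := h.weight_pos hk1 le_rfl
  have h1 := h.weight_mul_sub_le hp hL hf hc xmin le_rfl
  have hp1 : (1 : ℝ) ≤ p := by exact_mod_cast hp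
  -- The growth estimate divides by `‖x*‖`; if it vanishes, the energy bound already gives
  -- optimality.
  by_cases hx0 : xmin = 0
  · rw [hx0] at h1 ⊢
    simp only [norm_zero] at h1 ⊢
    have : f (y k) - f 0 ≤ 0 := by
      by_contra hcon
      have := mul_pos hAk (not_le.1 hcon)
      norm_num at h1
      linarith
    simpa using this
  have hR : 0 < ‖xmin‖ := norm_pos_iff.2 hx0
  have h2 := h.growth hp hL hf hc hmin hx0 hk1 le_rfl
  have hk0 : (0 : ℝ) < k := by exact_mod_cast hk1
  set m : ℝ := (3 * (p : ℝ) + 1) / 2 with hm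
  have hkm : 0 < (k : ℝ) ^ m := Real.rpow_pos_of_pos hk0 _
  have h3 : ((p : ℝ) + 1) ^ (p + 1) ≤ ((p : ℝ) + 1) ^ m := by
    rw [← Real.rpow_natCast]
    refine Real.rpow_le_rpow_of_exponent_le (by linarith) ?_
    push_cast; rw [hm]; linarith
  have hfac : (0 : ℝ) < Nat.factorial (p - 1) := by positivity
  have h4 : (Nat.factorial (p - 1) : ℝ) * (k : ℝ) ^ m ≤
      2 * L * (((p : ℝ) + 1) ^ m * A k * (2 * ‖xmin‖) ^ (p - 1)) := by
    have : (Nat.factorial (p - 1) : ℝ) / (2 * L) * (k : ℝ) ^ m =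
      (Nat.factorial (p - 1) : ℝ) * (k : ℝ) ^ m / (2 * L) := by ring
    rw [this, div_le_iff₀ (by positivity)] at h2
    refine h2.trans ?_
    rw [mul_comm]
    gcongr
  have h5 : 0 ≤ f (y k) - f xmin := sub_nonneg.2 (hmin (Set.mem_univ _))
  rw [le_div_iff₀ hkm]
  have e1 : ‖xmin‖ ^ (p + 1) = ‖xmin‖ ^ (p - 1) * ‖xmin‖ ^ 2 := by
    rw [← pow_add]; congr 1; omega
  have e2 : 2 ^ (p - 1) * ((p : ℝ) + 1) ^ m / (Nat.factorial (p - 1) : ℝ) * L * ‖xmin‖ ^ (p + 1) =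
    (2 * L * (((p : ℝ) + 1) ^ m * (2 * ‖xmin‖) ^ (p - 1)) * (1 / 2 * ‖xmin‖ ^ 2)) /
      (Nat.factorial (p - 1) : ℝ) := by
    rw [e1, mul_pow]; ring
  rw [e2, le_div_iff₀ hfac]
  have h6 := mul_le_mul_of_nonneg_left h4 h5
  have h7 := mul_le_mul_of_nonneg_left h1
    (show 0 ≤ 2 * L * (((p : ℝ) + 1) ^ m * (2 * ‖xmin‖) ^ (p - 1)) by positivity)
  calc _ = (f (y k) - f xmin) * ((Nat.factorial (p - 1) : ℝ) * (k : ℝ) ^ m) := by ring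
    _ ≤ _ := h6
    _ = 2 * L * (((p : ℝ) + 1) ^ m * (2 * ‖xmin‖) ^ (p - 1)) * (A k * (f (y k) - f xmin)) := by ring
    _ ≤ _ := h7

end Rate

/-! ### The bisection procedure and its invariants. -/

section Search

variable {d p : ℕ} {L : ℝ} {f : Vec d → ℝ}

/-- A minimizer of `w ↦ g w + (L / p!) ‖w - q‖^(p+1)`, if there is one. -/
def modelArgmin {d : ℕ} (p : ℕ) (L : ℝ) (g : Vec d → ℝ) (q : Vec d) : Vec d :=
  Classical.epsilon fun y =>
    IsMinOn (fun w => g w + L / (Nat.factorial p : ℝ) * ‖w - q‖ ^ (p + 1)) Set.univ y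

/-- The quantity that has to lie in `[1/2, p/(p+1)]` for an admissible step. -/
def stepRatio (p : ℕ) (L lam r : ℝ) : ℝ :=
  lam * (L * r ^ (p - 1) / (Nat.factorial (p - 1) : ℝ))

/-- The step size for which the extrapolation is `θ • y + (1 - θ) • x`. -/
def segmentLam (A θ : ℝ) : ℝ := A * (1 - θ) ^ 2 / θ

/-- The point with parameter `θ` on the segment from `x` to `y`. -/
def segmentPoint {d : ℕ} (x y : Vec d) (θ : ℝ) : Vec d := θ • y + (1 - θ) • x

/-- Bisection on the segment parameter; `z` is the model minimizer at the upper end. -/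
def bisection {d : ℕ} (p : ℕ) (L A : ℝ) (x y : Vec d) :
    ℕ → ℝ → ℝ → Vec d → OracleAlg d (SearchOutput d)
  -- An expansion evaluated at its own center returns the value of `f`; two calls are reserved for
  -- this comparison.
  | 0, _, _, z => .query y fun g₁ => .query z fun g₂ =>
      .output (.accurate (open Classical in if g₁ y ≤ g₂ z then y else z))
  | N + 1, lo, hi, z => .query (segmentPoint x y ((lo + hi) / 2)) fun g =>
      open Classical in
      if stepRatio p L (segmentLam A ((lo + hi) / 2))
          ‖modelArgmin p L g (segmentPoint x y ((lo + hi) / 2)) -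
            segmentPoint x y ((lo + hi) / 2)‖ < 1 / 2 then
        bisection p L A x y N lo ((lo + hi) / 2)
          (modelArgmin p L g (segmentPoint x y ((lo + hi) / 2)))
      else if stepRatio p L (segmentLam A ((lo + hi) / 2))
          ‖modelArgmin p L g (segmentPoint x y ((lo + hi) / 2)) -
            segmentPoint x y ((lo + hi) / 2)‖ ≤ (p : ℝ) / ((p : ℝ) + 1) then
        .output (.iterate (segmentLam A ((lo + hi) / 2))
          (modelArgmin p L g (segmentPoint x y ((lo + hi) / 2))))
      else bisection p L A x y N ((lo + hi) / 2) hi z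

/-- The line search with at most `n` oracle calls. -/
def lineSearch {d : ℕ} (p : ℕ) (L : ℝ) (n : ℕ) (A : ℝ) (x y : Vec d) :
    OracleAlg d (SearchOutput d) :=
  open Classical in
  if n = 0 then .output (.accurate 0)
  else if p = 1 then
    .query (extrapolation A x y (1 / (2 * L))) fun g =>
      .output (.iterate (1 / (2 * L)) (modelArgmin p L g (extrapolation A x y (1 / (2 * L)))))
  else if A = 0 then
    .query x fun g =>
      if modelArgmin p L g x = x then .output (.accurate x)
      else .output (.iterate
        ((Nat.factorial (p - 1) : ℝ) / (2 * L * ‖modelArgmin p L g x - x‖ ^ (p - 1)))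
        (modelArgmin p L g x))
  -- Arbitrary output: for `p ≥ 2` the required budget is at least `2`.
  else if n = 1 then .output (.accurate 0)
  else bisection p L A x y (n - 2) 0 1 y

lemma bisection_calls_le (A : ℝ) (x y : Vec d) (O : Vec d → Vec d → ℝ) (N : ℕ) :
    ∀ (lo hi : ℝ) (z : Vec d), (bisection p L A x y N lo hi z).calls O ≤ N + 2 := by
  induction N with
  | zero => intro lo hi z; simp [bisection, OracleAlg.calls]
  | succ N ih =>
    intro lo hi z
    simp only [bisection, OracleAlg.calls]
    split_ifs
    · have := ih lo ((lo + hi) / 2) (modelArgmin p L (O (segmentPoint x y ((lo + hi) / 2)))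
        (segmentPoint x y ((lo + hi) / 2)))
      omega
    · simp [OracleAlg.calls]
    · have := ih ((lo + hi) / 2) hi z
      omega

lemma lineSearch_calls_le (n : ℕ) (A : ℝ) (x y : Vec d) (O : Vec d → Vec d → ℝ) :
    (lineSearch p L n A x y).calls O ≤ n := by
  unfold lineSearch
  split_ifs with h0 h1 h2 h3
  · simp [OracleAlg.calls]
  · simp only [OracleAlg.calls]; omega
  · simp only [OracleAlg.calls]
    split_ifs <;> simp only [OracleAlg.calls] <;> omega
  · simp [OracleAlg.calls]
  · have := bisection_calls_le (p := p) (L := L) A x y O (n - 2) 0 1 y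
    omega

lemma isMinOn_modelArgmin (hp : 1 ≤ p) (hL : 0 < L) (hf : HasLipschitzDeriv p L f)
    {xmin : Vec d} (hmin : IsMinOn f Set.univ xmin) (q : Vec d) :
    IsMinOn (regularizedModel p L f q) Set.univ (modelArgmin p L (taylorExpansion p f q) q) :=
  Classical.epsilon_spec (exists_isMinOn_regularizedModel hp hL hf hmin q)

/-- For this `λ` the discriminant is a perfect square and `a = A (1 - θ) / θ`, so `A / (A + a) = θ`.
-/
lemma extrapolation_segmentLam {A θ : ℝ} (hA : 0 < A) (h0 : 0 < θ) (h1 : θ < 1) (x y : Vec d) :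
    extrapolation A x y (segmentLam A θ) = segmentPoint x y θ := by
  have h2 : stepWeight A (segmentLam A θ) = A * (1 - θ) / θ := by
    unfold stepWeight segmentLam
    have : (A * (1 - θ) ^ 2 / θ) ^ 2 + 4 * (A * (1 - θ) ^ 2 / θ) * A =
        (A * (1 - θ) * (1 + θ) / θ) ^ 2 := by field_simp; ring
    have h3 : 0 < 1 - θ := by linarith
    rw [this, Real.sqrt_sq (by positivity)]
    field_simp
    ring
  unfold extrapolation segmentPoint
  have h3 : A + A * (1 - θ) / θ = A / θ := by field_simp; ring
  rw [h2, h3]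
  congr 2
  · field_simp
  · field_simp

lemma segmentLam_pos {A θ : ℝ} (hA : 0 < A) (h0 : 0 < θ) (h1 : θ < 1) : 0 < segmentLam A θ := by
  have h3 : 0 < 1 - θ := by linarith
  unfold segmentLam; positivity

/-- The lower end of a bisection bracket. -/
def IsLowerEnd {d : ℕ} (p : ℕ) (L : ℝ) (f : Vec d → ℝ) (A : ℝ) (x y : Vec d) (lo : ℝ) : Prop :=
  lo = 0 ∨ (0 < lo ∧ ∃ a, IsMinOn (regularizedModel p L f (segmentPoint x y lo)) Set.univ a ∧
    (p : ℝ) / ((p : ℝ) + 1) < stepRatio p L (segmentLam A lo) ‖a - segmentPoint x y lo‖)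

/-- The upper end of a bisection bracket, with the model minimizer there. -/
def IsUpperEnd {d : ℕ} (p : ℕ) (L : ℝ) (f : Vec d → ℝ) (A : ℝ) (x y : Vec d) (hi : ℝ)
    (z : Vec d) : Prop :=
  hi = 1 ∨ (hi < 1 ∧ IsMinOn (regularizedModel p L f (segmentPoint x y hi)) Set.univ z ∧
    stepRatio p L (segmentLam A hi) ‖z - segmentPoint x y hi‖ < 1 / 2)

lemma IsLowerEnd.nonneg {A lo : ℝ} {x y : Vec d} (h : IsLowerEnd p L f A x y lo) : 0 ≤ lo :=
  h.elim (fun h => h.ge) fun h => h.1.le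

lemma IsUpperEnd.le_one {A hi : ℝ} {x y z : Vec d} (h : IsUpperEnd p L f A x y hi z) : hi ≤ 1 :=
  h.elim (fun h => h.le) fun h => h.1.le

lemma bisection_correct (hp : 1 ≤ p) (hL : 0 < L) (hf : HasLipschitzDeriv p L f)
    {xmin : Vec d} (hmin : IsMinOn f Set.univ xmin) {A ε h : ℝ} (hA : 0 < A) (hh : 0 < h)
    {x y : Vec d}
    (hend : ∀ lo hi z, IsLowerEnd p L f A x y lo → IsUpperEnd p L f A x y hi z → hi - lo = h →
      f y - f xmin ≤ ε ∨ f z - f xmin ≤ ε) (N : ℕ) :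
    ∀ lo hi z, IsLowerEnd p L f A x y lo → IsUpperEnd p L f A x y hi z → hi - lo = 2 ^ N * h →
      SearchOutput.Correct p L f (f xmin) ε A x y
        ((bisection p L A x y N lo hi z).result (taylorExpansion p f)) := by
  induction N with
  | zero =>
    intro lo hi z hlo hhi hd
    have := hend lo hi z hlo hhi (by simpa using hd)
    simp only [bisection, OracleAlg.result, SearchOutput.Correct, taylorExpansion_self]
    split_ifs with hyz
    · rcases this with h1 | h1 <;> linarith
    · rcases this with h1 | h1 <;> linarith
  | succ N ih =>
    intro lo hi z hlo hhi hd
    have hpos : 0 < (2 : ℝ) ^ N * h := by positivity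
    rw [pow_succ] at hd
    set θ := (lo + hi) / 2 with hθ
    have hθ0 : 0 < θ := by have := hlo.nonneg; rw [hθ]; linarith
    have hθ1 : θ < 1 := by have := hhi.le_one; rw [hθ]; linarith
    have hw := isMinOn_modelArgmin hp hL hf hmin (segmentPoint x y θ)
    simp only [bisection, OracleAlg.result, ← hθ]
    split_ifs with h1 h2
    · exact ih _ _ _ hlo (Or.inr ⟨hθ1, hw, h1⟩) (by rw [hθ]; linarith)
    · simp only [OracleAlg.result, SearchOutput.Correct]
      unfold IsATDStep
      rw [extrapolation_segmentLam hA hθ0 hθ1]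
      exact ⟨segmentLam_pos hA hθ0 hθ1, not_lt.1 h1, h2, hw⟩
    · exact ih _ _ _ (Or.inr ⟨hθ0, _, hw, not_le.1 h2⟩) hhi (by rw [hθ]; linarith)

end Search

/-! ### Numerical contradictions for a short bracket. -/

section Terminal

variable {d p : ℕ} {L : ℝ} {f : Vec d → ℝ}

lemma le_pow_of_le_two_pow {P c : ℝ} (hP : 2 ≤ P) (n : ℕ) (hc : c ≤ 2 ^ n) : c ≤ P ^ n :=
  hc.trans (pow_le_pow_left₀ (by norm_num) hP n)

/-- The bracket cannot be close to the `y` end: the weight would be too large. -/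
lemma false_of_upper_near_one {P R h A lo r : ℝ} (hp : 2 ≤ p) (hP : P = p) (hL : 0 < L)
    (hR : 0 < R) (hh : 0 < h) (hA : 0 < A) (hr0 : 0 ≤ r) (hr : r ≤ 6 * R)
    (hprec : h * P ^ (30 * p - 3) ≤ 1)
    (hy : 2 * A * (h * P ^ (30 * p - 3)) * L * R ^ (p - 1) < 1)
    (hlo : 1 / 2 ≤ lo) (hlo1 : lo ≤ 1) (hnear : 1 - lo ≤ 101 * h)
    (hratio : 2 / 3 ≤ segmentLam A lo * L * r ^ (p - 1)) : False := by
  have hP2 : 2 ≤ P := by rw [hP]; exact_mod_cast hp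
  have h1 : segmentLam A lo ≤ A * (101 * h) ^ 2 * 2 := by
    unfold segmentLam
    rw [div_le_iff₀ (by linarith)]
    have h2 : (1 - lo) ^ 2 ≤ (101 * h) ^ 2 := pow_le_pow_left₀ (by linarith) hnear 2
    have h3 : A * (1 - lo) ^ 2 ≤ A * (101 * h) ^ 2 := mul_le_mul_of_nonneg_left h2 hA.le
    have h4 : 0 ≤ A * (101 * h) ^ 2 := by positivity
    nlinarith
  have h2 : r ^ (p - 1) ≤ 6 ^ (p - 1) * R ^ (p - 1) := by
    rw [← mul_pow]; exact pow_le_pow_left₀ hr0 hr _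
  have h3 : segmentLam A lo * L * r ^ (p - 1) ≤
      A * (101 * h) ^ 2 * 2 * L * (6 ^ (p - 1) * R ^ (p - 1)) := by gcongr
  -- Here `20402 = 2 · 101²`. Since `P ≥ 2`, numerical constants are absorbed into powers of `P`.
  have h4 : (20402 : ℝ) * 6 ^ (p - 1) ≤ P ^ (30 * p - 3) := by
    calc (20402 : ℝ) * 6 ^ (p - 1) ≤ P ^ 15 * (P ^ 3) ^ (p - 1) := by
          gcongr
          · exact le_pow_of_le_two_pow hP2 15 (by norm_num)
          · exact le_pow_of_le_two_pow hP2 3 (by norm_num)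
      _ = P ^ (15 + 3 * (p - 1)) := by rw [← pow_mul, ← pow_add]
      _ ≤ _ := pow_le_pow_right₀ (by linarith) (by omega)
  have hh1 : h ≤ 1 := by
    have : (1 : ℝ) ≤ P ^ (30 * p - 3) := one_le_pow₀ (by linarith)
    nlinarith
  have h5 : A * (101 * h) ^ 2 * 2 * L * (6 ^ (p - 1) * R ^ (p - 1)) =
      A * h * L * R ^ (p - 1) * (20402 * 6 ^ (p - 1)) * h := by ring
  have hB : 0 < A * h * L * R ^ (p - 1) := by positivity
  have h6 : A * h * L * R ^ (p - 1) * (20402 * 6 ^ (p - 1)) * h ≤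
      A * h * L * R ^ (p - 1) * P ^ (30 * p - 3) * 1 := by
    gcongr
  have h7 : 2 * A * (h * P ^ (30 * p - 3)) * L * R ^ (p - 1) =
    2 * (A * h * L * R ^ (p - 1) * P ^ (30 * p - 3) * 1) := by ring
  linarith

/-- The bracket cannot be close to the `x` end: the step would be too short. -/
lemma false_of_lower_near_zero {P R h A hi r : ℝ} (hp : 2 ≤ p) (hP : P = p) (hL : 0 < L)
    (hR : 0 < R) (hh : 0 < h) (hA : 0 < A) (hr0 : 0 ≤ r) (hr : r ≤ 6 * R)
    (hA1 : (Nat.factorial (p - 1) : ℝ) ≤ 2 * (A * L * (2 * R) ^ (p - 1)))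
    (hz : h * P ^ (30 * p - 3) * R ^ p < P ^ 5 * r ^ p)
    (hhi0 : 0 < hi) (hhi : hi ≤ 1 / 2) (hnear : hi ≤ 101 * h)
    (hratio : segmentLam A hi * L * r ^ (p - 1) < 1 / 2 * (Nat.factorial (p - 1) : ℝ)) :
    False := by
  have hP2 : 2 ≤ P := by rw [hP]; exact_mod_cast hp
  -- From `(1 - hi)² ≥ 1/4` and `hi ≤ 101 h`.
  have h1 : A / (404 * h) ≤ segmentLam A hi := by
    unfold segmentLam
    rw [div_le_div_iff₀ (by positivity) hhi0]
    have h2 : (1 / 2) ^ 2 ≤ (1 - hi) ^ 2 := pow_le_pow_left₀ (by norm_num) (by linarith) 2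
    have h3 : A * hi ≤ A * (101 * h) := mul_le_mul_of_nonneg_left hnear hA.le
    have h4 : A * (1 / 2) ^ 2 * (404 * h) ≤ A * (1 - hi) ^ 2 * (404 * h) := by gcongr
    nlinarith
  have h2 : A / (404 * h) * L * r ^ (p - 1) ≤ A * L * (2 * R) ^ (p - 1) := by
    have : A / (404 * h) * L * r ^ (p - 1) ≤ segmentLam A hi * L * r ^ (p - 1) := by gcongr
    linarith
  have h3 : r ^ (p - 1) ≤ 404 * h * (2 ^ (p - 1) * R ^ (p - 1)) := by
    rw [← mul_pow]
    have e : A / (404 * h) * L * r ^ (p - 1) = (A * L) * (r ^ (p - 1) / (404 * h)) := by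
      field_simp
    rw [e] at h2
    have := le_of_mul_le_mul_left h2 (by positivity)
    rw [div_le_iff₀ (by positivity)] at this
    linarith
  have e1 : r ^ p = r ^ (p - 1) * r := by rw [← pow_succ, Nat.sub_add_cancel (by omega)]
  have e2 : R ^ p = R ^ (p - 1) * R := by rw [← pow_succ, Nat.sub_add_cancel (by omega)]
  have h4 : P ^ 5 * r ^ p ≤ P ^ 5 * (404 * h * (2 ^ (p - 1) * R ^ (p - 1)) * (6 * R)) := by
    rw [e1]; gcongr
  have h5 : P ^ 5 * (2424 * 2 ^ (p - 1)) ≤ P ^ (30 * p - 3) := by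
    calc P ^ 5 * (2424 * 2 ^ (p - 1)) ≤ P ^ 5 * (P ^ 12 * P ^ (p - 1)) := by
          gcongr
          exact le_pow_of_le_two_pow hP2 12 (by norm_num)
      _ = P ^ (5 + (12 + (p - 1))) := by rw [← pow_add, ← pow_add]
      _ ≤ _ := pow_le_pow_right₀ (by linarith) (by omega)
  have h6 : P ^ 5 * (404 * h * (2 ^ (p - 1) * R ^ (p - 1)) * (6 * R)) =
      h * (P ^ 5 * (2424 * 2 ^ (p - 1))) * R ^ p := by rw [e2]; ring
  have h7 : h * (P ^ 5 * (2424 * 2 ^ (p - 1))) * R ^ p ≤ h * P ^ (30 * p - 3) * R ^ p := by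
    gcongr
  linarith

/-- A narrow bracket in the interior forces the two step lengths to be nearly equal. -/
lemma le_of_narrow_bracket {P R h s rlo rhi D : ℝ} (hp : 2 ≤ p) (hP : P = p)
    (hR : 0 < R) (hh : 0 < h) (hs0 : 0 ≤ s) (hs : s ≤ h * (4 * R)) (hrlo0 : 0 ≤ rlo)
    (hrhi0 : 0 ≤ rhi) (hrhi : rhi ≤ 6 * R)
    (hz : h * P ^ (30 * p - 3) * R ^ p < P ^ 5 * rhi ^ p)
    (hD : rlo - rhi - s ≤ D)
    (hstab : ∀ M, rlo + s ≤ M → rhi + s ≤ M →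
      2 * (D / 2) ^ (p + 1) ≤ (P + 2) * (P + 1) * M ^ p * s) :
    (1 - 1 / (10 * P)) * rlo ≤ rhi := by
  by_contra hcon
  rw [not_le] at hcon
  have hP2 : 2 ≤ P := by rw [hP]; exact_mod_cast hp
  have hP0 : 0 < P := by linarith
  have hη : 0 < 1 / (10 * P) := by positivity
  have hrle : rhi ≤ rlo := by nlinarith
  have hrlopos : 0 < rlo := by
    rcases hrlo0.eq_or_lt with h0 | h0
    · rw [← h0] at hcon; linarith
    · exact h0
  have e1 : rhi ^ p = rhi ^ (p - 1) * rhi := by rw [← pow_succ, Nat.sub_add_cancel (by omega)]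
  have e2 : R ^ p = R ^ (p - 1) * R := by rw [← pow_succ, Nat.sub_add_cancel (by omega)]
  have h1 : P ^ 5 * rhi ^ p ≤ P ^ (3 * p + 2) * rhi * R ^ (p - 1) := by
    calc P ^ 5 * rhi ^ p ≤ P ^ 5 * ((6 * R) ^ (p - 1) * rhi) := by rw [e1]; gcongr
      _ = P ^ 5 * 6 ^ (p - 1) * rhi * R ^ (p - 1) := by rw [mul_pow]; ring
      _ ≤ P ^ 5 * (P ^ 3) ^ (p - 1) * rhi * R ^ (p - 1) := by
          gcongr
          exact le_pow_of_le_two_pow hP2 3 (by norm_num)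
      _ = _ := by
          rw [← pow_mul, ← pow_add]
          congr 3; omega
  -- Inaccuracy of the upper point makes its step far longer than the displacement `s` of the
  -- center.
  have h2 : h * R * P ^ (27 * p - 5) ≤ rhi := by
    have e3 : P ^ (30 * p - 3) = P ^ (3 * p + 2) * P ^ (27 * p - 5) := by
      rw [← pow_add]; congr 1; omega
    have h3 : (P ^ (3 * p + 2) * R ^ (p - 1)) * (h * R * P ^ (27 * p - 5)) ≤
        (P ^ (3 * p + 2) * R ^ (p - 1)) * rhi := by
      calc _ = h * P ^ (30 * p - 3) * R ^ p := by rw [e3, e2]; ring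
        _ ≤ _ := hz.le
        _ ≤ _ := h1
        _ = _ := by ring
    exact le_of_mul_le_mul_left h3 (by positivity)
  have h3 : s * P ^ (27 * p - 7) ≤ rlo := by
    calc s * P ^ (27 * p - 7) ≤ h * (P ^ 2 * R) * P ^ (27 * p - 7) := by
          gcongr
          refine hs.trans ?_
          gcongr
          exact le_pow_of_le_two_pow hP2 2 (by norm_num)
      _ = h * R * P ^ (27 * p - 5) := by
          have : P ^ (27 * p - 5) = P ^ 2 * P ^ (27 * p - 7) := by
            rw [← pow_add]; congr 1; omega
          rw [this]; ring
      _ ≤ rlo := h2.trans hrle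
  have h4 : 20 * P * s ≤ rlo := by
    refine le_trans ?_ h3
    rw [mul_comm]
    gcongr
    calc 20 * P ≤ P ^ 5 * P := by gcongr; exact le_pow_of_le_two_pow hP2 5 (by norm_num)
      _ = P ^ 6 := by ring
      _ ≤ _ := pow_le_pow_right₀ (by linarith) (by omega)
  have h5 : s ≤ rlo / (20 * P) := by rw [le_div_iff₀ (by positivity)]; linarith
  have h6 : rlo / (20 * P) ≤ D := by
    have e : (1 - 1 / (10 * P)) * rlo = rlo - 2 * (rlo / (20 * P)) := by field_simp; ring
    linarith
  have h7 : s ≤ rlo := by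
    refine h5.trans ((div_le_iff₀ (by positivity)).2 ?_)
    nlinarith
  -- If the lengths differ by the fraction `1/(10P)`, then `D ≥ rlo/(20P)`, and stability with `M =
  -- 2 rlo` bounds `rlo` by a multiple of `s` too small for `h3`.
  have h8 := hstab (2 * rlo) (by linarith) (by linarith)
  have h9 : 2 * (rlo / (20 * P) / 2) ^ (p + 1) ≤ (P + 2) * (P + 1) * (2 * rlo) ^ p * s := by
    refine le_trans ?_ h8
    gcongr
  have e4 : rlo / (20 * P) / 2 = rlo / (40 * P) := by ring
  rw [e4, div_pow, mul_div_assoc', div_le_iff₀ (by positivity)] at h9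
  have h10 : rlo ^ p * (2 * rlo) ≤ rlo ^ p * ((P + 2) * (P + 1) * 2 ^ p * (40 * P) ^ (p + 1) * s) := by
    calc _ = 2 * rlo ^ (p + 1) := by ring
      _ ≤ _ := h9
      _ = _ := by rw [mul_pow]; ring
  have h11 := le_of_mul_le_mul_left h10 (by positivity)
  have h12 : (P + 2) * (P + 1) * 2 ^ p * (40 * P) ^ (p + 1) ≤ P ^ (27 * p - 7) := by
    calc (P + 2) * (P + 1) * 2 ^ p * (40 * P) ^ (p + 1) ≤
        P ^ 2 * P ^ 2 * P ^ p * (P ^ 7) ^ (p + 1) := by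
          gcongr
          · nlinarith
          · nlinarith
          · calc 40 * P ≤ P ^ 6 * P := by gcongr; exact le_pow_of_le_two_pow hP2 6 (by norm_num)
              _ = P ^ 7 := by ring
      _ = P ^ (2 + 2 + p + 7 * (p + 1)) := by rw [← pow_mul, ← pow_add, ← pow_add, ← pow_add]
      _ ≤ _ := pow_le_pow_right₀ (by linarith) (by omega)
  have h13 := mul_le_mul_of_nonneg_right h12 hs0
  linarith

/-- A narrow bracket in the interior contradicts the gap between the two step ratios. -/
lemma false_of_interior {P h A lo hi rlo rhi F : ℝ} (hp : 2 ≤ p) (hP : P = p) (hL : 0 < L)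
    (hA : 0 < A) (hF : 0 < F) (hrlo0 : 0 ≤ rlo)
    (hlen : hi - lo = h) (hh : 0 < h) (hlo : 100 * h ≤ lo) (hhi : 100 * h ≤ 1 - hi)
    (hr : (1 - 1 / (10 * P)) * rlo ≤ rhi)
    (hrlo : 2 / 3 * F ≤ segmentLam A lo * L * rlo ^ (p - 1))
    (hrhi : segmentLam A hi * L * rhi ^ (p - 1) < 1 / 2 * F) : False := by
  have hP2 : 2 ≤ P := by rw [hP]; exact_mod_cast hp
  have hlo0 : 0 < lo := by linarith
  have hhi0 : 0 < hi := by linarith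
  have hhi1 : 0 < 1 - hi := by linarith
  have h1 : 0.9 * segmentLam A lo ≤ segmentLam A hi := by
    unfold segmentLam
    rw [← mul_div_assoc, div_le_div_iff₀ hlo0 hhi0]
    have h2 : hi ≤ 1.01 * lo := by linarith
    have h3 : (1 - lo) ^ 2 ≤ (1.01 * (1 - hi)) ^ 2 :=
      pow_le_pow_left₀ (by linarith) (by linarith) 2
    have h4 : 0.9 * (A * (1 - lo) ^ 2) * hi ≤
        0.9 * (A * (1.01 * (1 - hi)) ^ 2) * (1.01 * lo) := by gcongr
    have h5 : 0 ≤ A * (1 - hi) ^ 2 * lo := by positivity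
    have h6 : 0.9 * (A * (1.01 * (1 - hi)) ^ 2) * (1.01 * lo) =
      0.9 * 1.01 ^ 3 * (A * (1 - hi) ^ 2 * lo) := by ring
    have h7 : 0.9 * 1.01 ^ 3 * (A * (1 - hi) ^ 2 * lo) ≤ 1 * (A * (1 - hi) ^ 2 * lo) :=
      mul_le_mul_of_nonneg_right (by norm_num) h5
    linarith
  have h2 : 0.9 * rlo ^ (p - 1) ≤ rhi ^ (p - 1) := by
    have hη : 1 / (10 * P) ≤ 1 := by
      rw [div_le_one (by positivity)]; linarith
    have h3 := one_add_mul_le_pow (a := -(1 / (10 * P))) (by linarith) (p - 1)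
    have h4 : (0.9 : ℝ) ≤ 1 + ((p - 1 : ℕ) : ℝ) * -(1 / (10 * P)) := by
      have : ((p - 1 : ℕ) : ℝ) ≤ P := by rw [hP]; exact_mod_cast Nat.sub_le _ _
      have h5 : ((p - 1 : ℕ) : ℝ) * (1 / (10 * P)) ≤ P * (1 / (10 * P)) := by gcongr
      have h6 : P * (1 / (10 * P)) = 0.1 := by field_simp; norm_num
      linarith
    calc 0.9 * rlo ^ (p - 1) ≤ (1 + -(1 / (10 * P))) ^ (p - 1) * rlo ^ (p - 1) := by
          gcongr; linarith
      _ = ((1 - 1 / (10 * P)) * rlo) ^ (p - 1) := by rw [mul_pow]; ring_nf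
      _ ≤ _ := by
          refine pow_le_pow_left₀ (mul_nonneg (by linarith) hrlo0) hr _
  have hlam0 : 0 ≤ segmentLam A lo := by unfold segmentLam; positivity
  have hlam1 : 0 ≤ segmentLam A hi := by linarith
  have h3 : (0.9 * segmentLam A lo) * L * (0.9 * rlo ^ (p - 1)) ≤
      segmentLam A hi * L * rhi ^ (p - 1) := by gcongr
  -- The contradiction is `0.9 · 0.9 · 2/3 = 0.54 > 1/2`.
  linarith

end Terminal

/-! ### Accuracy at the end of the bisection. -/

section Bracket

variable {d p : ℕ} {L : ℝ} {f : Vec d → ℝ} {xmin : Vec d}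

lemma norm_segmentPoint_sub_le {x y c : Vec d} {θ S : ℝ} (h0 : 0 ≤ θ) (h1 : θ ≤ 1)
    (hx : ‖x - c‖ ≤ S) (hy : ‖y - c‖ ≤ S) : ‖segmentPoint x y θ - c‖ ≤ S := by
  have e : segmentPoint x y θ - c = θ • (y - c) + (1 - θ) • (x - c) := by
    unfold segmentPoint; module
  rw [e]
  refine (norm_add_le _ _).trans ?_
  rw [norm_smul, norm_smul, Real.norm_of_nonneg h0, Real.norm_of_nonneg (by linarith)]
  nlinarith

lemma stepRatio_eq (lam r : ℝ) :
    stepRatio p L lam r = lam * L * r ^ (p - 1) / (Nat.factorial (p - 1) : ℝ) := by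
  unfold stepRatio; ring

lemma add_two_div_factorial_le (hp : 2 ≤ p) : ((p : ℝ) + 2) / (Nat.factorial p : ℝ) ≤ 2 := by
  rw [div_le_iff₀ (by positivity)]
  have h : p ≤ Nat.factorial p := Nat.self_le_factorial p
  have h1 : (p : ℝ) ≤ Nat.factorial p := by exact_mod_cast h
  have h2 : (2 : ℝ) ≤ p := by exact_mod_cast hp
  linarith

/-- When the bisection bracket is short, its upper end or the current point is accurate. -/
lemma accurate_of_short_bracket (hp : 2 ≤ p) (hL : 0 < L) (hf : HasLipschitzDeriv p L f)
    (hc : ConvexOn ℝ Set.univ f) (hmin : IsMinOn f Set.univ xmin) (hx0 : xmin ≠ 0)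
    {A ε h : ℝ} (hA : 0 < A) (hh : 0 < h) {x y : Vec d}
    (hx : ‖x - xmin‖ ≤ ‖xmin‖) (hy : ‖y - xmin‖ ≤ 3 * ‖xmin‖)
    (hyA : A * (f y - f xmin) ≤ 1 / 2 * ‖xmin‖ ^ 2)
    (hA1 : (Nat.factorial (p - 1) : ℝ) ≤ 2 * (A * L * (2 * ‖xmin‖) ^ (p - 1)))
    (hprec : h * (p : ℝ) ^ (30 * p - 3) ≤ 1)
    (hε : h * (p : ℝ) ^ (30 * p - 3) * L * ‖xmin‖ ^ (p + 1) ≤ ε)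
    {lo hi : ℝ} {z : Vec d} (hlo : IsLowerEnd p L f A x y lo) (hhi : IsUpperEnd p L f A x y hi z)
    (hlen : hi - lo = h) : f y - f xmin ≤ ε ∨ f z - f xmin ≤ ε := by
  by_contra hcon
  rw [not_or, not_le, not_le] at hcon
  obtain ⟨hyε, hzε⟩ := hcon
  have hp1 : 1 ≤ p := by omega
  set R := ‖xmin‖ with hRdef
  have hR : 0 < R := norm_pos_iff.2 hx0
  obtain ⟨P, hP⟩ : ∃ P : ℝ, P = p := ⟨_, rfl⟩
  rw [← hP] at hprec hε
  have hP2 : 2 ≤ P := by rw [hP]; exact_mod_cast hp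
  have hfac : (0 : ℝ) < Nat.factorial (p - 1) := by positivity
  have hfac1 : (1 : ℝ) ≤ Nat.factorial (p - 1) := by exact_mod_cast Nat.factorial_pos _
  have hlo0 := hlo.nonneg
  have hhi1 := hhi.le_one
  have hsmall : h ≤ 1 / 1000 := by
    have : (1000 : ℝ) ≤ P ^ (30 * p - 3) :=
      (le_pow_of_le_two_pow hP2 10 (by norm_num)).trans
        (pow_le_pow_right₀ (by linarith) (by omega))
    have h2 : h * 1000 ≤ h * P ^ (30 * p - 3) := by gcongr
    linarith
  have hseg : ∀ θ, 0 ≤ θ → θ ≤ 1 → ‖segmentPoint x y θ - xmin‖ ≤ 3 * R := fun θ h0 h1 =>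
    norm_segmentPoint_sub_le h0 h1 (by linarith) hy
  have hstep : ∀ θ, 0 ≤ θ → θ ≤ 1 → ∀ a,
      IsMinOn (regularizedModel p L f (segmentPoint x y θ)) Set.univ a →
      ‖a - segmentPoint x y θ‖ ≤ 6 * R := fun θ h0 h1 a ha => by
    have := norm_sub_le_of_isMinOn_regularizedModel hp1 hL hf hmin ha
    linarith [hseg θ h0 h1]
  -- Inaccuracy of `y` against the energy bound on `A (f y - f x*)`: the weight is not too large.
  have hyF : 2 * A * (h * P ^ (30 * p - 3)) * L * R ^ (p - 1) < 1 := by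
    have h1 : A * (h * P ^ (30 * p - 3) * L * R ^ (p + 1)) < 1 / 2 * R ^ 2 :=
      lt_of_lt_of_le (mul_lt_mul_of_pos_left (hε.trans_lt hyε) hA) hyA
    have e1 : R ^ (p + 1) = R ^ (p - 1) * R ^ 2 := by rw [← pow_add]; congr 1; omega
    rw [e1] at h1
    have hR2 : 0 < 1 / 2 * R ^ 2 := by positivity
    refine lt_of_mul_lt_mul_right ?_ hR2.le
    linarith
  -- Inaccuracy of `z` forces a long step; `18 ≤ P ^ 5` comes from `(p+2)/p! ≤ 2` and `‖z - x*‖ ≤ 9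
  -- R`.
  have hzF : hi < 1 → IsMinOn (regularizedModel p L f (segmentPoint x y hi)) Set.univ z →
      h * P ^ (30 * p - 3) * R ^ p < P ^ 5 * ‖z - segmentPoint x y hi‖ ^ p := by
    intro hhi' hz
    have h1 := sub_le_of_isMinOn_regularizedModel hp1 hL hf hc hz xmin
    have h2 := hstep hi (by linarith) hhi1 z hz
    set r := ‖z - segmentPoint x y hi‖ with hr
    have h3 : ‖z - xmin‖ ≤ 9 * R := by
      have e : z - xmin = (z - segmentPoint x y hi) + (segmentPoint x y hi - xmin) := by abel
      rw [e]
      exact (norm_add_le _ _).trans (by linarith [hseg hi (by linarith) hhi1])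
    have h4 : L * (p + 2) / (Nat.factorial p : ℝ) * r ^ p * ‖z - xmin‖ ≤
        L * 2 * r ^ p * (9 * R) := by
      rw [mul_div_assoc]
      have := add_two_div_factorial_le hp
      gcongr
    have h5 : L * 2 * r ^ p * (9 * R) ≤ (L * R) * (P ^ 5 * r ^ p) := by
      have h6 : (18 : ℝ) ≤ P ^ 5 := le_pow_of_le_two_pow hP2 5 (by norm_num)
      have h7 : L * 2 * r ^ p * (9 * R) = (L * R) * (18 * r ^ p) := by ring
      rw [h7]
      gcongr
    refine lt_of_mul_lt_mul_left ?_ (show 0 ≤ L * R by positivity)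
    calc L * R * (h * P ^ (30 * p - 3) * R ^ p) = h * P ^ (30 * p - 3) * L * R ^ (p + 1) := by ring
      _ ≤ ε := hε
      _ < f z - f xmin := hzε
      _ ≤ _ := h1
      _ ≤ _ := h4
      _ ≤ _ := h5
  have hloF : ∀ a, (p : ℝ) / ((p : ℝ) + 1) < stepRatio p L (segmentLam A lo)
      ‖a - segmentPoint x y lo‖ → 2 / 3 * (Nat.factorial (p - 1) : ℝ) ≤
      segmentLam A lo * L * ‖a - segmentPoint x y lo‖ ^ (p - 1) := by
    intro a ha
    rw [stepRatio_eq, lt_div_iff₀ hfac] at ha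
    have : (2 : ℝ) / 3 ≤ (p : ℝ) / ((p : ℝ) + 1) := by
      rw [div_le_div_iff₀ (by norm_num) (by positivity)]; linarith
    nlinarith
  have hhiF : stepRatio p L (segmentLam A hi) ‖z - segmentPoint x y hi‖ < 1 / 2 →
      segmentLam A hi * L * ‖z - segmentPoint x y hi‖ ^ (p - 1) <
        1 / 2 * (Nat.factorial (p - 1) : ℝ) := by
    intro hz
    rwa [stepRatio_eq, div_lt_iff₀ hfac] at hz
  by_cases hcase1 : 1 - hi < 100 * h
  · rcases hlo with hlo | ⟨-, a, ha, hra⟩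
    · linarith
    · have h1 := hloF a hra
      exact false_of_upper_near_one (lo := lo) hp hP hL hR hh hA (norm_nonneg _)
        (hstep lo hlo0 (by linarith) a ha) hprec hyF (by linarith) (by linarith) (by linarith)
        (by linarith)
  rw [not_lt] at hcase1
  rcases hhi with hhi | ⟨hhi', hz, hrz⟩
  · linarith
  have hrhi := hstep hi (by linarith) hhi1 z hz
  by_cases hcase2 : lo < 100 * h
  · exact false_of_lower_near_zero hp hP hL hR hh hA (norm_nonneg _) hrhi hA1 (hzF hhi' hz)
      (by linarith) (by linarith) (by linarith) (hhiF hrz)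
  rw [not_lt] at hcase2
  rcases hlo with hlo | ⟨-, a, ha, hra⟩
  · linarith
  have hs : ‖segmentPoint x y lo - segmentPoint x y hi‖ ≤ h * (4 * R) := by
    have e : segmentPoint x y lo - segmentPoint x y hi = (hi - lo) • (x - y) := by
      unfold segmentPoint; module
    rw [e, hlen, norm_smul, Real.norm_of_nonneg hh.le]
    gcongr
    have e2 : x - y = (x - xmin) - (y - xmin) := by abel
    rw [e2]
    exact (norm_sub_le _ _).trans (by linarith)
  have hr := le_of_narrow_bracket (s := ‖segmentPoint x y lo - segmentPoint x y hi‖)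
    (rlo := ‖a - segmentPoint x y lo‖) (rhi := ‖z - segmentPoint x y hi‖) (D := ‖a - z‖)
    hp hP hR hh (norm_nonneg _) hs (norm_nonneg _) (norm_nonneg _) hrhi (hzF hhi' hz) ?_
    (fun M h1 h2 => ?_)
  · exact false_of_interior hp hP hL hA hfac (norm_nonneg _) hlen hh hcase2 hcase1 hr
      (hloF a hra) (hhiF hrz)
  · have e : a - segmentPoint x y lo = (a - z) + (z - segmentPoint x y hi) -
        (segmentPoint x y lo - segmentPoint x y hi) := by abel
    have h1 : ‖a - segmentPoint x y lo‖ ≤ ‖a - z‖ + ‖z - segmentPoint x y hi‖ +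
        ‖segmentPoint x y lo - segmentPoint x y hi‖ := by
      rw [e]
      exact (norm_sub_le _ _).trans (by gcongr; exact norm_add_le _ _)
    linarith
  · rw [hP]
    exact norm_sub_pow_le_of_isMinOn_regularizedModel hp hL hf hc ha hz h1 h2

end Bracket

/-! ### Correctness of the line search within the call budget. -/

section LineSearch

variable {d p : ℕ} {L : ℝ} {f : Vec d → ℝ} {xmin : Vec d}

/-- For `p = 1` the origin is accurate as soon as no oracle call is required. -/
lemma sub_le_of_lipschitz_gradient (hf : HasLipschitzDeriv 1 L f) (hmin : IsMinOn f Set.univ xmin)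
    (hL : 0 < L) : f 0 - f xmin ≤ L * ‖xmin‖ ^ 2 := by
  have h := (abs_le.1 (hf.abs_sub_taylorExpansion_le xmin (-xmin))).2
  have h0 : fderiv ℝ f xmin = 0 := (hmin.isLocalMin Filter.univ_mem).fderiv_eq_zero
  have h1 : taylorExpansion 1 f xmin (xmin + -xmin) = f xmin := by
    simp [taylorExpansion, Finset.sum_range_succ, iteratedFDeriv_one_apply, h0]
  rw [h1, add_neg_cancel, norm_neg] at h
  norm_num at h
  nlinarith [sq_nonneg ‖xmin‖]

lemma pow_mul_lt_of_floor_le (hp : 1 ≤ p) {K n : ℕ}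
    (hn : ⌊30 * (p : ℝ) * Real.logb 2 p + Real.logb 2 (K : ℝ)⌋₊ ≤ n) (hK : 1 ≤ K) :
    (p : ℝ) ^ (30 * p) * K < 2 ^ (n + 1) := by
  have h1 : 30 * (p : ℝ) * Real.logb 2 p + Real.logb 2 (K : ℝ) < n + 1 :=
    (Nat.lt_floor_add_one _).trans_le (by exact_mod_cast Nat.add_le_add_right hn 1)
  have hp0 : (0 : ℝ) < p := by exact_mod_cast hp
  have hK0 : (0 : ℝ) < K := by exact_mod_cast hK
  have h2 : Real.logb 2 ((p : ℝ) ^ (30 * p) * K) < ((n + 1 : ℕ) : ℝ) := by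
    rw [Real.logb_mul (by positivity) hK0.ne', Real.logb_pow]
    push_cast
    exact h1
  rw [Real.logb_lt_iff_lt_rpow (by norm_num) (by positivity), Real.rpow_natCast] at h2
  exact h2

lemma isATDStep_of_weight_zero (hp : 1 ≤ p) (hL : 0 < L) {x y w : Vec d} (hw : w ≠ x)
    (hmin : IsMinOn (regularizedModel p L f x) Set.univ w) :
    IsATDStep p L f 0 x y
      ((Nat.factorial (p - 1) : ℝ) / (2 * L * ‖w - x‖ ^ (p - 1))) w := by
  have hr : 0 < ‖w - x‖ := norm_pos_iff.2 (sub_ne_zero.2 hw)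
  have hlam : 0 < (Nat.factorial (p - 1) : ℝ) / (2 * L * ‖w - x‖ ^ (p - 1)) := by positivity
  have hx : extrapolation 0 x y ((Nat.factorial (p - 1) : ℝ) / (2 * L * ‖w - x‖ ^ (p - 1))) = x := by
    have := stepWeight_pos le_rfl hlam
    simp [extrapolation, div_self this.ne']
  have hval : (Nat.factorial (p - 1) : ℝ) / (2 * L * ‖w - x‖ ^ (p - 1)) *
      (L * ‖w - x‖ ^ (p - 1) / (Nat.factorial (p - 1) : ℝ)) = 1 / 2 := by
    have : (Nat.factorial (p - 1) : ℝ) ≠ 0 := by positivity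
    field_simp
  have hp1 : (1 : ℝ) ≤ p := by exact_mod_cast hp
  refine ⟨hlam, ?_, ?_, ?_⟩
  · rw [hx, hval]
  · rw [hx, hval, div_le_div_iff₀ (by norm_num) (by positivity)]; linarith
  · rwa [hx]

theorem lineSearch_correct (hp : 1 ≤ p) (hL : 0 < L) (hc : ConvexOn ℝ Set.univ f)
    (hf : HasLipschitzDeriv p L f) (hmin : IsMinOn f Set.univ xmin) {k : ℕ} {lam A : ℕ → ℝ}
    {x y : ℕ → Vec d} (h : IsATDRun p L f k lam A x y) {ε : ℝ} (hε : 0 < ε) {n : ℕ}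
    (hn : ⌊30 * (p : ℝ) * Real.logb 2 p +
      Real.logb 2 (⌈L * ‖xmin‖ ^ (p + 1) / ε⌉₊ : ℝ)⌋₊ ≤ n) :
    SearchOutput.Correct p L f (f xmin) ε (A k) (x k) (y k)
      ((lineSearch p L n (A k) (x k) (y k)).result (taylorExpansion p f)) := by
  have hR0 : 0 ≤ ‖xmin‖ := norm_nonneg _
  have hceil := Nat.le_ceil (L * ‖xmin‖ ^ (p + 1) / ε)
  set K := ⌈L * ‖xmin‖ ^ (p + 1) / ε⌉₊ with hKdef
  -- If `x* = 0` then `K = 0`, and `Real.logb 2 0 = 0 = Real.logb 2 1` lets `M = 1` replace it.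
  have hn' : ∀ {M : ℕ}, 1 ≤ M → M ≤ max K 1 → (p : ℝ) ^ (30 * p) * M < 2 ^ (n + 1) := by
    intro M hM1 hM
    refine pow_mul_lt_of_floor_le hp (le_trans (Nat.floor_le_floor ?_) hn) hM1
    refine add_le_add_right ?_ _
    rcases Nat.eq_zero_or_pos K with h0 | h0
    · have : M = 1 := by omega
      simp [h0, this]
    · refine Real.logb_le_logb_of_le (by norm_num) (by exact_mod_cast hM1) ?_
      exact_mod_cast (by omega : M ≤ K)
  have hn1 := hn' le_rfl (le_max_right K 1)
  rw [Nat.cast_one, mul_one] at hn1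
  have hnbig : 2 ≤ p → 2 ≤ n := by
    intro hp2
    by_contra hlt
    have h1 : (2 : ℝ) ^ (n + 1) ≤ 2 ^ 2 := pow_le_pow_right₀ (by norm_num) (by omega)
    have h2 : (2 : ℝ) ^ 2 ≤ (p : ℝ) ^ (30 * p) :=
      (pow_le_pow_left₀ (by norm_num) (by exact_mod_cast hp2) 2).trans
        (pow_le_pow_right₀ (by exact_mod_cast hp) (by omega))
    linarith
  unfold lineSearch
  split_ifs with h0 h1 h2 h3
  · have hpp : p = 1 := by
      by_contra hne
      have := hnbig (by omega)
      omega
    subst hpp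
    simp only [OracleAlg.result, SearchOutput.Correct]
    refine (sub_le_of_lipschitz_gradient hf hmin hL).trans ?_
    -- With `p = 1` and `n = 0` this reads `max K 1 < 2`, that is `L ‖x*‖² ≤ ε`.
    have h4 := hn' (M := max K 1) (le_max_right _ _) le_rfl
    rw [h0] at h4
    norm_num at h4
    have h5 : K ≤ 1 := by exact_mod_cast h4
    have h6 : L * ‖xmin‖ ^ (1 + 1) / ε ≤ 1 := hceil.trans (by exact_mod_cast h5)
    rwa [div_le_one hε] at h6
  · subst h1
    have hw := isMinOn_modelArgmin hp hL hf hmin (extrapolation (A k) (x k) (y k) (1 / (2 * L)))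
    refine ⟨by positivity, ?_, ?_, hw⟩
    · simp only [Nat.sub_self, pow_zero, Nat.factorial_zero]
      field_simp
      norm_num
    · simp only [Nat.sub_self, pow_zero, Nat.factorial_zero]
      field_simp
      norm_num
  · have hw := isMinOn_modelArgmin hp hL hf hmin (x k)
    simp only [OracleAlg.result]
    split_ifs with h4
    · simp only [OracleAlg.result, SearchOutput.Correct]
      have h5 := sub_le_of_isMinOn_regularizedModel hp hL hf hc hw xmin
      rw [h4, sub_self, norm_zero, zero_pow (by omega), mul_zero, zero_mul] at h5
      linarith
    · simp only [OracleAlg.result, SearchOutput.Correct, h2]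
      exact isATDStep_of_weight_zero hp hL h4 hw
  · have := hnbig (by omega)
    omega
  · have hp2 : 2 ≤ p := by omega
    have hn2 := hnbig hp2
    have hk1 : 1 ≤ k := by
      rcases Nat.eq_zero_or_pos k with hk | hk
      · exact absurd (hk ▸ h.A_zero) h2
      · exact hk
    have hA := h.weight_pos hk1 le_rfl
    have hyA := h.weight_mul_sub_le hp hL hf hc xmin le_rfl
    refine bisection_correct (h := 1 / 2 ^ (n - 2)) hp hL hf hmin hA (by positivity) ?_ (n - 2) 0 1 (y k)
      (Or.inl rfl) (Or.inl rfl) (by field_simp; ring)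
    intro lo hi z hlo hhi hlen
    by_cases hx0 : xmin = 0
    · left
      have h4 : A k * (f (y k) - f xmin) ≤ 0 := by
        refine hyA.trans (le_of_eq ?_)
        rw [hx0]; simp
      by_contra hcon
      have := mul_pos hA (hε.trans (not_le.1 hcon))
      linarith
    have hR : 0 < ‖xmin‖ := norm_pos_iff.2 hx0
    have hK1 : 1 ≤ K := Nat.one_le_iff_ne_zero.2 (Nat.ceil_pos.2 (by positivity)).ne'
    have h4 := hn' hK1 (le_max_left K 1)
    have hp2' : (2 : ℝ) ≤ p := by exact_mod_cast hp2
    -- The floor and the two reserved calls cost a factor `2 ^ 3`, paid by `p ^ 3`; hence the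
    -- exponent `30 p - 3`.
    have h5 : 1 / 2 ^ (n - 2) * (p : ℝ) ^ (30 * p - 3) * K ≤ 1 := by
      have e1 : (p : ℝ) ^ (30 * p) = (p : ℝ) ^ (30 * p - 3) * (p : ℝ) ^ 3 := by
        rw [← pow_add]; congr 1; omega
      have e2 : (2 : ℝ) ^ (n + 1) = 2 ^ (n - 2) * 8 := by
        rw [show n + 1 = (n - 2) + 3 by omega, pow_add]; norm_num
      rw [e1, e2] at h4
      have h6 : (8 : ℝ) ≤ (p : ℝ) ^ 3 := le_pow_of_le_two_pow hp2' 3 (by norm_num)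
      have h7 : (p : ℝ) ^ (30 * p - 3) * K * 8 ≤ (p : ℝ) ^ (30 * p - 3) * K * (p : ℝ) ^ 3 := by
        gcongr
      have h8 : (p : ℝ) ^ (30 * p - 3) * K ≤ 2 ^ (n - 2) := by linarith
      rw [mul_assoc, one_div_mul_eq_div, div_le_one (by positivity)]
      exact h8
    have hK1' : (1 : ℝ) ≤ K := by exact_mod_cast hK1
    have hQ : 0 < 1 / 2 ^ (n - 2) * (p : ℝ) ^ (30 * p - 3) := by positivity
    refine accurate_of_short_bracket hp2 hL hf hc hmin hx0 hA (by positivity)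
      (h.norm_x_sub_le hp hL hf hc hmin le_rfl) (h.norm_y_sub_le hp hL hf hc hmin k le_rfl) hyA
      (h.factorial_le hp hL hf hmin hk1 le_rfl) ?_ ?_ hlo hhi hlen
    · nlinarith
    · rw [div_le_iff₀ hε] at hceil
      calc _ = 1 / 2 ^ (n - 2) * (p : ℝ) ^ (30 * p - 3) * (L * ‖xmin‖ ^ (p + 1)) := by ring
        _ ≤ 1 / 2 ^ (n - 2) * (p : ℝ) ^ (30 * p - 3) * (K * ε) := by gcongr
        _ = 1 / 2 ^ (n - 2) * (p : ℝ) ^ (30 * p - 3) * K * ε := by ring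
        _ ≤ 1 * ε := by gcongr
        _ = ε := one_mul ε

end LineSearch

end

theorem theorem1 (d p : ℕ) (hp : 1 ≤ p) (L : ℝ) (hL : 0 < L) :
    -- the rate of convergence of every execution of Accelerated Taylor Descent
    (∀ (f : Vec d → ℝ) (xmin : Vec d),
      ConvexOn ℝ Set.univ f → HasLipschitzDeriv p L f → IsMinOn f Set.univ xmin →
      ∀ (k : ℕ) (lam A : ℕ → ℝ) (x y : ℕ → Vec d), 1 ≤ k → IsATDRun p L f k lam A x y →
        f (y k) - f xmin ≤
          (2 ^ (p - 1) * ((p : ℝ) + 1) ^ ((3 * (p : ℝ) + 1) / 2) / (Nat.factorial (p - 1) : ℝ)) *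
            L * ‖xmin‖ ^ (p + 1) / (k : ℝ) ^ ((3 * (p : ℝ) + 1) / 2)) ∧
    -- the oracle complexity of one iteration: `search n A x y` is the line search with at most
    -- `n` oracle calls from the state `(A, x, y)`; it does not depend on `f`
    (∃ search : ℕ → ℝ → Vec d → Vec d → OracleAlg d (SearchOutput d),
      (∀ (n : ℕ) (A : ℝ) (x y : Vec d) (O : Vec d → Vec d → ℝ),
        (search n A x y).calls O ≤ n) ∧
      ∀ (f : Vec d → ℝ) (xmin : Vec d),
        ConvexOn ℝ Set.univ f → HasLipschitzDeriv p L f → IsMinOn f Set.univ xmin →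
        ∀ (k : ℕ) (lam A : ℕ → ℝ) (x y : ℕ → Vec d), IsATDRun p L f k lam A x y →
        ∀ (ε : ℝ), 0 < ε → ∀ n : ℕ,
          ⌊30 * (p : ℝ) * Real.logb 2 p +
              Real.logb 2 (⌈L * ‖xmin‖ ^ (p + 1) / ε⌉₊ : ℝ)⌋₊ ≤ n →
          SearchOutput.Correct p L f (f xmin) ε (A k) (x k) (y k)
            ((search n (A k) (x k) (y k)).result (taylorExpansion p f))) := by
  exact ⟨fun f xmin hc hf hmin k lam A x y hk h => h.rate hp hL hf hc hmin hk,
    lineSearch p L, fun n A x y O => lineSearch_calls_le n A x y O,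
    fun f xmin hc hf hmin k lam A x y h ε hε n hn =>
      lineSearch_correct hp hL hc hf hmin h hε hn⟩
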